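/- Let $\mathcal D(n,p)$ denote the random digraph on the vertex set $[n]$ in which each of the $n(n-1)$ arcs $\overrightarrow{uv}$, $u\neq v$, is present independently with probability $p$. A Hamilton cycle of a digraph is a directed cycle passing through every vertex exactly once. Let $p=p(n)\in[0,1]$ satisfy $p=\omega\!\left(\frac{\log^4 n}{n}\right)$, i.e. $\frac{\log^4 n}{n\,p(n)}\to 0$ as $n\to\infty$. Then there is a sequence $\varepsilon_n\to 0$ such that, with probability tending to $1$ as $n\to\infty$, the digraph $D\sim\mathcal D(n,p)$ contains at least $(1-\varepsilon_n)np$ pairwise arc-disjoint directed Hamilton cycles. -/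

import Mathlib

namespace Digraph

/-- The set of arcs of a digraph, as ordered pairs of vertices. -/
def arcSet {V : Type*} (D : Digraph V) : Set (V × V) :=
  {a | D.Adj a.1 a.2}

/-- The digraph whose arcs are exactly the elements of `S`. -/
def ofArcSet {V : Type*} (S : Set (V × V)) : Digraph V where
  Adj u v := (u, v) ∈ S

/-- `C` is the arc set of a directed Hamilton cycle of `D`: for some cyclic enumeration
`v 0, v 1, …, v (n - 1)` of all the vertices, each listed exactly once (indices modulo the
number `n` of vertices), `C` consists of the arcs `(v i, v (i + 1))`, all of which are arcs
of `D`. -/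
def IsHamiltonCycle {V : Type*} [Finite V] (D : Digraph V) (C : Set (V × V)) : Prop :=
  ∃ v : ZMod (Nat.card V) ≃ V,
    C = Set.range (fun i => (v i, v (i + 1))) ∧ C ⊆ D.arcSet

/-- `F` is a family of pairwise arc-disjoint directed Hamilton cycles of `D`, each cycle being
given by its arc set. -/
def IsHamiltonPacking {V : Type*} [Finite V] (D : Digraph V) (F : Finset (Set (V × V))) : Prop :=
  (∀ C ∈ F, D.IsHamiltonCycle C) ∧
    ∀ C ∈ F, ∀ C' ∈ F, C ≠ C' → Disjoint C C'

/-- Digraphs on the finite vertex set `Fin n` carry the discrete σ-algebra. -/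
instance instMeasurableSpaceFin (n : ℕ) : MeasurableSpace (Digraph (Fin n)) := ⊤

/-- The random digraph `D(n, p)`: the law of the digraph on `Fin n` that contains each of the
`n (n - 1)` arcs `(u, v)` with `u ≠ v` independently with probability `p`, and no loops. -/
noncomputable def random (n : ℕ) (p : unitInterval) : MeasureTheory.Measure (Digraph (Fin n)) :=
  (ProbabilityTheory.setBernoulli {a : Fin n × Fin n | a.1 ≠ a.2} p).map ofArcSet

theorem measurable_ofArcSet (n : ℕ) :
    Measurable (ofArcSet : Set (Fin n × Fin n) → Digraph (Fin n)) :=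
  measurable_of_countable _

instance instIsProbabilityMeasureRandom (n : ℕ) (p : unitInterval) :
    MeasureTheory.IsProbabilityMeasure (random n p) :=
  MeasureTheory.Measure.isProbabilityMeasure_map (measurable_ofArcSet n).aemeasurable

end Digraph

namespace HamiltonPacking

/-!
Split the `n` vertices into `L ≈ log² n` clusters of equal size `m`, with `L` prime, and fewer than
`L` leftover vertices. For every step `a ≠ 0` the residues `0, a, 2 a, …` modulo `L` run through all
clusters, and walks with different steps use different arcs. Composing perfect matchings of the
slots between consecutive clusters along step `a` gives a permutation of one cluster, and the union
of these matchings is a Hamilton cycle as soon as that permutation is a single cycle. The leftover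
vertices are absorbed in one slot, by a matching between the two clusters extended by all of them.

Independent random labels decide which arcs serve in matchings and which are reserved for closing
walks. By Hall's theorem and Chernoff's bound, the matching arcs of a slot contain nearly `m p`
disjoint perfect matchings. In one slot, each walk uses instead a matching of reserved arcs that
makes its permutation a single cycle. Finding it amounts to finding a Hamilton cycle in a random
digraph of density `q ≈ log n / m`, by McDiarmid's coupling and Pósa rotations. Since the `m p`
walks with a given step are closed at about `L` different slots, only the fraction
`q m / L ≈ log n / L` of the arcs has to be reserved.
-/

open MeasureTheory ProbabilityTheory

section Freezing

variable {Ω β Λ : Type*} [MeasurableSpace Ω] {μ : Measure Ω} [IsProbabilityMeasure μ] [Finite β]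
  [MeasurableSpace Λ] {X : β → Ω → Λ} {E E' : Set (β → Λ)}

lemma lintegral_measure_piecewise (hX : iIndepFun X μ) (hm : ∀ b, Measurable (X b)) (T : Set β)
    [∀ b, Decidable (b ∈ T)] (hE : MeasurableSet E) :
    ∫⁻ ω', μ {ω | T.piecewise (fun b ↦ X b ω) (fun b ↦ X b ω') ∈ E} ∂μ =
      μ {ω | (fun b ↦ X b ω) ∈ E} := by
  classical
  have := Fintype.ofFinite β
  let S := T.toFinset
  let A : Ω → (↥Sᶜ → Λ) := fun ω b ↦ X b ω
  let B : Ω → (S → Λ) := fun ω b ↦ X b ω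
  have hA : Measurable A := measurable_pi_lambda _ fun b ↦ hm b
  have hB : Measurable B := measurable_pi_lambda _ fun b ↦ hm b
  have hAB : IndepFun A B μ := hX.indepFun_finset Sᶜ S disjoint_compl_left hm
  let glue : (↥Sᶜ → Λ) × (S → Λ) → β → Λ := fun g b ↦
    if hb : b ∈ S then g.2 ⟨b, hb⟩ else g.1 ⟨b, Finset.mem_compl.2 hb⟩
  have hglue : Measurable glue := by
    refine measurable_pi_lambda _ fun b ↦ ?_
    by_cases hb : b ∈ S
    · simpa only [glue, hb, dite_true] using by fun_prop
    · simpa only [glue, hb, dite_false] using by fun_prop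
  have hpiecewise (ω ω' : Ω) :
      T.piecewise (fun b ↦ X b ω) (fun b ↦ X b ω') = glue (A ω', B ω) := by
    ext b
    by_cases hb : b ∈ T <;> simp [glue, S, A, B, hb]
  calc ∫⁻ ω', μ {ω | T.piecewise (fun b ↦ X b ω) (fun b ↦ X b ω') ∈ E} ∂μ
      = ∫⁻ ω', μ.map B (Prod.mk (A ω') ⁻¹' (glue ⁻¹' E)) ∂μ := by
        refine lintegral_congr fun ω' ↦ ?_
        rw [Measure.map_apply hB (measurable_prodMk_left (hglue hE))]
        simp only [hpiecewise]
        rfl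
    _ = (μ.map A).prod (μ.map B) (glue ⁻¹' E) := by
        rw [Measure.prod_apply (hglue hE),
          lintegral_map (measurable_measure_prodMk_left (hglue hE)) hA]
    _ = μ {ω | (fun b ↦ X b ω) ∈ E} := by
        rw [← (indepFun_iff_map_prod_eq_prod_map_map hA.aemeasurable hB.aemeasurable).1 hAB,
          Measure.map_apply (hA.prodMk hB) (hglue hE)]
        congr 1
        ext ω
        simp only [Set.mem_preimage, ← hpiecewise, Set.piecewise_same, Set.mem_ofPred_eq]

lemma measureReal_le_of_piecewise_le (hX : iIndepFun X μ) (hm : ∀ b, Measurable (X b)) (T : Set β)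
    [∀ b, Decidable (b ∈ T)] (hE : MeasurableSet E) {c : ℝ}
    (h : ∀ f, μ.real {ω | T.piecewise (fun b ↦ X b ω) f ∈ E} ≤ c) :
    μ.real {ω | (fun b ↦ X b ω) ∈ E} ≤ c := by
  have : Nonempty Ω := nonempty_of_isProbabilityMeasure μ
  have hc : 0 ≤ c := measureReal_nonneg.trans (h fun b ↦ X b (Classical.arbitrary Ω))
  refine ENNReal.toReal_le_of_le_ofReal hc ?_
  rw [← lintegral_measure_piecewise hX hm T hE]
  calc ∫⁻ ω', μ {ω | T.piecewise (fun b ↦ X b ω) (fun b ↦ X b ω') ∈ E} ∂μ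
      ≤ ∫⁻ _, ENNReal.ofReal c ∂μ :=
        lintegral_mono fun _ ↦ (ENNReal.le_ofReal_iff_toReal_le (measure_ne_top _ _) hc).2 (h _)
    _ = ENNReal.ofReal c := by simp

lemma measureReal_mono_of_piecewise_le (hX : iIndepFun X μ) (hm : ∀ b, Measurable (X b))
    (T : Set β) [∀ b, Decidable (b ∈ T)] (hE : MeasurableSet E) (hE' : MeasurableSet E')
    (h : ∀ f, μ.real {ω | T.piecewise (fun b ↦ X b ω) f ∈ E} ≤
      μ.real {ω | T.piecewise (fun b ↦ X b ω) f ∈ E'}) :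
    μ.real {ω | (fun b ↦ X b ω) ∈ E} ≤ μ.real {ω | (fun b ↦ X b ω) ∈ E'} := by
  refine ENNReal.toReal_mono (measure_ne_top _ _) ?_
  rw [← lintegral_measure_piecewise hX hm T hE, ← lintegral_measure_piecewise hX hm T hE']
  exact lintegral_mono fun _ ↦
    (ENNReal.toReal_le_toReal (measure_ne_top _ _) (measure_ne_top _ _)).1 (h _)

end Freezing

section Bernoulli

variable {Ω β γ : Type*} [MeasurableSpace Ω] {μ : Measure Ω} {ξ : β → Ω → Prop} {q : ℝ}

/-- `ξ` is a family of independent random propositions, each true with probability `q`; it stands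
for the random set of those arcs, or bipartite edges, `b` for which `ξ b` holds. -/
structure IsBernoulliFamily (ξ : β → Ω → Prop) (q : ℝ) (μ : Measure Ω) : Prop where
  measurable : ∀ b, Measurable (ξ b)
  indep : iIndepFun ξ μ
  prob : ∀ b, μ.real {ω | ξ b ω} = q

namespace IsBernoulliFamily

lemma precomp (h : IsBernoulliFamily ξ q μ) {g : γ → β} (hg : Function.Injective g) :
    IsBernoulliFamily (fun c ↦ ξ (g c)) q μ :=
  ⟨fun _ ↦ h.measurable _, h.indep.precomp hg, fun _ ↦ h.prob _⟩

lemma measurableSet (h : IsBernoulliFamily ξ q μ) (b : β) : MeasurableSet {ω | ξ b ω} :=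
  measurableSet_setOfPred.2 (h.measurable b)

lemma measurableSet_preimage [Finite β] (h : IsBernoulliFamily ξ q μ) (E : Set (β → Prop)) :
    MeasurableSet {ω | (fun b ↦ ξ b ω) ∈ E} :=
  measurable_pi_lambda (fun ω b ↦ ξ b ω) h.measurable E.toFinite.measurableSet

lemma nonneg (h : IsBernoulliFamily ξ q μ) [Nonempty β] : 0 ≤ q :=
  h.prob (Classical.arbitrary β) ▸ measureReal_nonneg

variable [IsProbabilityMeasure μ]

lemma le_one (h : IsBernoulliFamily ξ q μ) [Nonempty β] : q ≤ 1 :=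
  h.prob (Classical.arbitrary β) ▸ measureReal_le_one

lemma measureReal_forall_not (h : IsBernoulliFamily ξ q μ) (s : Finset β) :
    μ.real {ω | ∀ b ∈ s, ¬ ξ b ω} = (1 - q) ^ s.card := by
  have hinter : {ω | ∀ b ∈ s, ¬ ξ b ω} = ⋂ b ∈ s, ξ b ⁻¹' {False} := by
    ext ω; simp
  rw [hinter, measureReal_def, h.indep.measure_inter_preimage_eq_mul s fun _ _ ↦ .of_discrete,
    ENNReal.toReal_prod, Finset.prod_eq_pow_card]
  intro b _
  have hcompl : ξ b ⁻¹' {False} = {ω | ξ b ω}ᶜ := by ext ω; simp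
  rw [hcompl, ← measureReal_def, probReal_compl_eq_one_sub (h.measurableSet b), h.prob]

lemma measureReal_forall_not_le (h : IsBernoulliFamily ξ q μ) {s : Finset β} {k : ℕ}
    (hk : k ≤ s.card) : μ.real {ω | ∀ b ∈ s, ¬ ξ b ω} ≤ Real.exp (-(q * k)) := by
  rcases s.eq_empty_or_nonempty with rfl | ⟨b, -⟩
  · simp [Nat.le_zero.1 hk]
  have : Nonempty β := ⟨b⟩
  have hq := h.nonneg
  have hq' := h.le_one
  calc μ.real {ω | ∀ b ∈ s, ¬ ξ b ω} = (1 - q) ^ s.card := h.measureReal_forall_not s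
    _ ≤ (1 - q) ^ k := pow_le_pow_of_le_one (by linarith) (by linarith) hk
    _ ≤ Real.exp (-q) ^ k := pow_le_pow_left₀ (by linarith) (Real.one_sub_le_exp_neg q) k
    _ = Real.exp (-(q * k)) := by rw [← Real.exp_nat_mul]; ring_nf

end IsBernoulliFamily

end Bernoulli

section Chernoff

variable {Ω β : Type*} [MeasurableSpace Ω] {μ : Measure Ω} [IsProbabilityMeasure μ]
  {ξ : β → Ω → Prop} {q δ : ℝ}

lemma exp_neg_le_quadratic (hδ : 0 ≤ δ) : Real.exp (-δ) ≤ 1 - δ + δ ^ 2 / 2 := by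
  have hpos : 0 ≤ 1 - δ + δ ^ 2 / 2 := by nlinarith [sq_nonneg (δ - 1)]
  rw [Real.exp_neg, inv_le_iff_one_le_mul₀ (Real.exp_pos δ)]
  nlinarith [mul_le_mul_of_nonneg_left (Real.quadratic_le_exp_of_nonneg hδ) hpos,
    sq_nonneg (δ ^ 2)]

lemma mgf_indicator_neg_le {s : Set Ω} (hs : MeasurableSet s) (hδ : 0 ≤ δ) :
    mgf (s.indicator 1) μ (-δ) ≤ Real.exp (μ.real s * (-δ + δ ^ 2 / 2)) := by
  have hexp : (fun ω ↦ Real.exp (-δ * s.indicator 1 ω)) =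
      fun ω ↦ 1 + s.indicator (fun _ ↦ Real.exp (-δ) - 1) ω := by
    ext ω
    by_cases hω : ω ∈ s <;> simp [hω]
  calc mgf (s.indicator 1) μ (-δ) = 1 + μ.real s * (Real.exp (-δ) - 1) := by
        rw [mgf, hexp, integral_add (integrable_const _) ((integrable_const _).indicator hs),
          integral_indicator_const _ hs]
        simp
    _ ≤ μ.real s * (-δ + δ ^ 2 / 2) + 1 := by
        nlinarith [exp_neg_le_quadratic hδ, measureReal_nonneg (μ := μ) (s := s)]
    _ ≤ _ := Real.add_one_le_exp _

open Classical in
lemma IsBernoulliFamily.measureReal_card_filter_le (h : IsBernoulliFamily ξ q μ) (s : Finset β)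
    (hδ : 0 ≤ δ) :
    μ.real {ω | ((s.filter (ξ · ω)).card : ℝ) ≤ (1 - δ) * (q * s.card)} ≤
      Real.exp (-(δ ^ 2 / 2 * (q * s.card))) := by
  let Y : β → Ω → ℝ := fun b ↦ {ω | ξ b ω}.indicator 1
  have hYm (b : β) : Measurable (Y b) := measurable_one.indicator (h.measurableSet b)
  have hYi : iIndepFun Y μ := by
    convert h.indep.comp (fun _ (a : Prop) ↦ if a then (1 : ℝ) else 0) fun _ ↦ .of_discrete using 2
    ext ω
    simp [Y, Set.indicator_apply]
  have hcard (ω : Ω) : ((s.filter (ξ · ω)).card : ℝ) = (∑ b ∈ s, Y b) ω := by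
    simp [Y, Finset.sum_apply, Set.indicator_apply]
  have hmgf : mgf (∑ b ∈ s, Y b) μ (-δ) ≤ Real.exp (s.card * (q * (-δ + δ ^ 2 / 2))) := by
    rw [hYi.mgf_sum hYm, Real.exp_nat_mul, ← Finset.prod_const]
    refine Finset.prod_le_prod (fun _ _ ↦ mgf_nonneg) fun b _ ↦ ?_
    exact h.prob b ▸ mgf_indicator_neg_le (h.measurableSet b) hδ
  have hint : Integrable (fun ω ↦ Real.exp (-δ * (∑ b ∈ s, Y b) ω)) μ := by
    refine Integrable.of_bound (C := 1) ?_ (ae_of_all _ fun ω ↦ ?_)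
    · simp only [Finset.sum_apply]
      exact (by fun_prop : Measurable _).aestronglyMeasurable
    · rw [Real.norm_eq_abs, Real.abs_exp, Real.exp_le_one_iff, ← hcard]
      exact mul_nonpos_of_nonpos_of_nonneg (neg_nonpos.2 hδ) (Nat.cast_nonneg _)
  simp only [hcard]
  calc μ.real {ω | (∑ b ∈ s, Y b) ω ≤ (1 - δ) * (q * s.card)}
      ≤ Real.exp (δ * ((1 - δ) * (q * s.card))) * mgf (∑ b ∈ s, Y b) μ (-δ) := by
        simpa using measure_le_le_exp_mul_mgf _ (neg_nonpos.2 hδ) hint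
    _ ≤ Real.exp (δ * ((1 - δ) * (q * s.card))) *
          Real.exp (s.card * (q * (-δ + δ ^ 2 / 2))) := by gcongr
    _ = Real.exp (-(δ ^ 2 / 2 * (q * s.card))) := by rw [← Real.exp_add]; ring_nf

end Chernoff

section Infix

variable {V : Type*} {l l' l₁ l₂ : List V} {a b c : V}

lemma infix_pair_append (h : [a, b] <:+: l₁ ++ l₂) :
    [a, b] <:+: l₁ ∨ [a, b] <:+: l₂ ∨ l₁.getLast? = some a := by
  rcases List.infix_append_iff.1 h with h₁ | h₂ | ⟨s, t, hst, hs, ht⟩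
  · exact .inl h₁
  · exact .inr (.inl h₂)
  match s with
  | [] => exact .inr (.inl (hst ▸ ht.isInfix))
  | [_] =>
    obtain ⟨r, rfl⟩ := hs
    obtain ⟨rfl, -⟩ := List.cons_eq_cons.1 hst
    exact .inr (.inr (by simp))
  | _ :: _ :: _ =>
    obtain ⟨rfl, h⟩ := List.cons_eq_cons.1 hst
    obtain rfl := (List.cons_eq_cons.1 h).1
    obtain ⟨rfl, -⟩ := List.nil_eq_append_iff.1 (List.cons_eq_cons.1 h).2
    exact .inl hs.isInfix

lemma append_cons_inj_of_nodup (hl : (l ++ a :: l₁).Nodup)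
    (h : l ++ a :: l₁ = l' ++ a :: l₂) : l = l' ∧ l₁ = l₂ := by
  have ha : a ∉ l ∧ a ∉ l₁ := by simpa using (List.nodup_cons.1 (List.nodup_middle.1 hl)).1
  obtain ⟨hl, -, hl₁⟩ := (List.append_cons_inj_of_notMem ha.1 ha.2).1 h
  exact ⟨hl, hl₁⟩

lemma eq_of_infix_pair_right (hl : l.Nodup) (hb : [a, b] <:+: l) (hc : [a, c] <:+: l) :
    b = c := by
  obtain ⟨s, t, rfl⟩ := hb
  obtain ⟨s', t', h⟩ := hc
  obtain ⟨-, h⟩ := append_cons_inj_of_nodup (l := s) (a := a) (l₁ := b :: t) (by simpa using hl)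
    (l' := s') (l₂ := c :: t') (by simpa using h.symm)
  exact (List.cons_eq_cons.1 h).1

lemma eq_of_infix_pair_left (hl : l.Nodup) (ha : [a, c] <:+: l) (hb : [b, c] <:+: l) : a = b :=
  eq_of_infix_pair_right (List.nodup_reverse.2 hl) (by simpa using List.reverse_infix.2 ha)
    (by simpa using List.reverse_infix.2 hb)

lemma not_infix_pair_swap (hl : l.Nodup) (h : [a, b] <:+: l) : ¬ [b, a] <:+: l := by
  rintro ⟨s', t', h'⟩
  obtain ⟨s, t, rfl⟩ := h
  obtain ⟨rfl, -⟩ := append_cons_inj_of_nodup (l := s) (a := a) (l₁ := b :: t)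
    (by simpa using hl) (l' := s' ++ [b]) (l₂ := t') (by simpa using h'.symm)
  simp [List.nodup_append] at hl

lemma exists_infix_pair_left (hb : b ∈ l) (h : l.head? ≠ some b) : ∃ a, [a, b] <:+: l := by
  obtain ⟨s, t, rfl⟩ := List.append_of_mem hb
  rcases List.eq_nil_or_concat s with rfl | ⟨s, a, rfl⟩
  · simp at h
  · exact ⟨a, s, t, by simp⟩

lemma exists_infix_pair_right (ha : a ∈ l) (h : l.getLast? ≠ some a) : ∃ b, [a, b] <:+: l := by
  obtain ⟨b, hb⟩ := exists_infix_pair_left (List.mem_reverse.2 ha) (by rwa [List.head?_reverse])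
  exact ⟨b, by simpa using List.reverse_infix.2 hb⟩

end Infix

section Rotation

variable {V : Type*} {G G' : SimpleGraph V} {A : Set V} {l l₀ : List V} {x y z w : V}

/-- `l` is the vertex list of a path of `G` inside `A`. -/
structure IsPathIn (G : SimpleGraph V) (A : Set V) (l : List V) : Prop where
  nodup : l.Nodup
  isChain : l.IsChain G.Adj
  mem : ∀ x ∈ l, x ∈ A

/-- `l` is a path of `G` inside `A` with as many vertices as possible. -/
structure IsLongestPathIn (G : SimpleGraph V) (A : Set V) (l : List V) : Prop
    extends IsPathIn G A l where
  length_le : ∀ l', IsPathIn G A l' → l'.length ≤ l.length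

lemma IsPathIn.cons (hl : IsPathIn G A l) (hy : y ∈ A) (hyl : y ∉ l) (hx : l.head? = some x)
    (hyx : G.Adj y x) : IsPathIn G A (y :: l) where
  nodup := List.nodup_cons.2 ⟨hyl, hl.nodup⟩
  isChain := hl.isChain.cons (by simpa [hx] using hyx)
  mem := List.forall_mem_cons.2 ⟨hy, hl.mem⟩

lemma IsPathIn.reverse (hl : IsPathIn G A l) : IsPathIn G A l.reverse where
  nodup := List.nodup_reverse.2 hl.nodup
  isChain := List.isChain_reverse.2 (hl.isChain.imp fun _ _ h ↦ h.symm)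
  mem := by simpa using hl.mem

lemma IsPathIn.congr (h : ∀ u ∈ A, ∀ v ∈ A, G.Adj u v → G'.Adj u v) (hl : IsPathIn G A l) :
    IsPathIn G' A l where
  nodup := hl.nodup
  isChain := hl.isChain.imp_of_mem_imp fun u v hu hv ↦ h u (hl.mem u hu) v (hl.mem v hv)
  mem := hl.mem

lemma IsLongestPathIn.congr (h : ∀ u ∈ A, ∀ v ∈ A, (G.Adj u v ↔ G'.Adj u v))
    (hl : IsLongestPathIn G A l) : IsLongestPathIn G' A l where
  toIsPathIn := hl.toIsPathIn.congr fun u hu v hv ↦ (h u hu v hv).1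
  length_le l' hl' := hl.length_le l' (hl'.congr fun u hu v hv ↦ (h u hu v hv).2)

lemma IsLongestPathIn.reverse (hl : IsLongestPathIn G A l) : IsLongestPathIn G A l.reverse where
  toIsPathIn := hl.toIsPathIn.reverse
  length_le l' hl' := by simpa using hl.length_le l' hl'

lemma IsLongestPathIn.mem_of_adj_head (hl : IsLongestPathIn G A l) (hx : l.head? = some x)
    (hy : y ∈ A) (hxy : G.Adj x y) : y ∈ l := by
  by_contra hyl
  simpa using hl.length_le _ (hl.cons hy hyl hx hxy.symm)

lemma IsLongestPathIn.ne_nil (hl : IsLongestPathIn G A l) (hx : x ∈ A) : l ≠ [] := by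
  rintro rfl
  simpa using hl.length_le [x] ⟨by simp, by simp, by simpa using hx⟩

lemma exists_isLongestPathIn [Finite V] (G : SimpleGraph V) (A : Set V) :
    ∃ l, IsLongestPathIn G A l := by
  have := Fintype.ofFinite V
  obtain ⟨l, hl, h⟩ := Set.exists_max_image {l | IsPathIn G A l} List.length
    ((List.finite_length_le V (Fintype.card V)).subset fun _ hl ↦ hl.nodup.length_le_card)
    ⟨[], by simp, by simp, by simp⟩
  exact ⟨l, hl, h⟩

/-- The relation between a path `l₀` and the paths obtained from it by Pósa rotations that keep the
last vertex fixed: an edge from the first vertex `x` to a later vertex `w` allows to reverse the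
part of the path that precedes `w`. -/
inductive Rotates (G : SimpleGraph V) (l₀ : List V) : List V → Prop
  | refl : Rotates G l₀ l₀
  | step (x : V) (t : List V) (w : V) (s : List V) (h : Rotates G l₀ ((x :: t) ++ w :: s))
      (hxw : G.Adj x w) : Rotates G l₀ ((x :: t).reverse ++ w :: s)

lemma Rotates.perm (h : Rotates G l₀ l) : l.Perm l₀ := by
  induction h with
  | refl => rfl
  | step x t w s _ _ ih => exact ((List.reverse_perm _).append_right _).trans ih

lemma Rotates.isPathIn (h : Rotates G l₀ l) (h₀ : IsPathIn G A l₀) : IsPathIn G A l where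
  nodup := h.perm.nodup_iff.2 h₀.nodup
  mem x hx := h₀.mem x (h.perm.mem_iff.1 hx)
  isChain := by
    induction h with
    | refl => exact h₀.isChain
    | step x t w s _ hxw ih =>
      obtain ⟨ht, hs, -⟩ := List.isChain_append.1 ih
      refine List.isChain_append.2
        ⟨List.isChain_reverse.2 (ht.imp fun _ _ h ↦ h.symm), hs, fun a ha b hb ↦ ?_⟩
      obtain rfl : x = a := by simpa using ha
      obtain rfl : w = b := by simpa using hb
      exact hxw

lemma Rotates.isLongestPathIn (h : Rotates G l₀ l) (h₀ : IsLongestPathIn G A l₀) :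
    IsLongestPathIn G A l where
  toIsPathIn := h.isPathIn h₀.toIsPathIn
  length_le l' hl' := h.perm.length_eq ▸ h₀.length_le l' hl'

lemma Rotates.getLast? (h : Rotates G l₀ l) : l.getLast? = l₀.getLast? := by
  induction h with
  | refl => rfl
  | step x t w s _ _ ih => simp [← ih, List.getLast?_cons]

variable [Fintype V]

open Classical in
/-- The first vertices of the rotations of the path `l₀`. -/
noncomputable def rotationEnds (G : SimpleGraph V) (l₀ : List V) : Finset V :=
  {x | ∃ l, Rotates G l₀ l ∧ l.head? = some x}

lemma mem_rotationEnds : x ∈ rotationEnds G l₀ ↔ ∃ l, Rotates G l₀ l ∧ l.head? = some x := by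
  simp [rotationEnds]

lemma rotationEnds_nonempty (h : l₀ ≠ []) : (rotationEnds G l₀).Nonempty :=
  ⟨l₀.head h, mem_rotationEnds.2 ⟨l₀, .refl, List.head?_eq_some_head h⟩⟩

lemma Rotates.mem_rotationEnds_of_infix (h : Rotates G l₀ l) (hx : l.head? = some x)
    (hzy : [z, y] <:+: l) (hxy : G.Adj x y) : z ∈ rotationEnds G l₀ := by
  obtain ⟨s, s', rfl⟩ := hzy
  obtain ⟨t, ht⟩ : ∃ t, s ++ [z] = x :: t := by cases s <;> simp_all
  refine mem_rotationEnds.2 ⟨(x :: t).reverse ++ y :: s', .step x t y s' ?_ hxy, by simp [← ht]⟩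
  simpa [← ht] using h

/-- Consecutive vertices of the original path that never become the first vertex stay consecutive,
because a rotation only breaks the pair whose first vertex it makes an end. -/
lemma Rotates.infix_pair (h : Rotates G l₀ l) (hz : z ∉ rotationEnds G l₀)
    (hy : y ∉ rotationEnds G l₀) (hzy : [z, y] <:+: l₀ ∨ [y, z] <:+: l₀) :
    [z, y] <:+: l ∨ [y, z] <:+: l := by
  induction h with
  | refl => exact hzy
  | step x t w s h hxw ih =>
    have survives (a b : V) (ha : a ∉ rotationEnds G l₀) (hab : [a, b] <:+: (x :: t) ++ w :: s) :
        [a, b] <:+: (x :: t).reverse ++ w :: s ∨ [b, a] <:+: (x :: t).reverse ++ w :: s := by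
      rcases infix_pair_append hab with h₁ | h₂ | hlast
      · have : [b, a] <:+: (x :: t).reverse := by simpa using List.reverse_infix.2 h₁
        exact .inr (this.trans (List.prefix_append _ _).isInfix)
      · exact .inl (h₂.trans (List.suffix_append _ _).isInfix)
      · refine absurd (mem_rotationEnds.2 ⟨_, .step x t w s h hxw, ?_⟩) ha
        rw [List.head?_append, List.head?_reverse, hlast, Option.some_or]
    exact ih.elim (survives z y hz) fun h' ↦ (survives y z hy h').symm

lemma IsLongestPathIn.exists_infix_pair_of_adj (h₀ : IsLongestPathIn G A l₀)
    (hx : x ∈ rotationEnds G l₀) (hyA : y ∈ A) (hy : y ∉ rotationEnds G l₀) (hxy : G.Adj x y)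
    (hlast : l₀.getLast? ≠ some y) :
    ∃ z ∈ rotationEnds G l₀, [z, y] <:+: l₀ ∨ [y, z] <:+: l₀ := by
  obtain ⟨l, hl, hlx⟩ := mem_rotationEnds.1 hx
  have hlong := hl.isLongestPathIn h₀
  have hyl : y ∈ l := hlong.mem_of_adj_head hlx hyA hxy
  have hfirst {l' : List V} (hl' : Rotates G l₀ l') : l'.head? ≠ some y := fun h ↦
    hy (mem_rotationEnds.2 ⟨l', hl', h⟩)
  obtain ⟨z, hzy⟩ := exists_infix_pair_left hyl (hfirst hl)
  have hz : z ∈ rotationEnds G l₀ := hl.mem_rotationEnds_of_infix hlx hzy hxy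
  have hyl₀ : y ∈ l₀ := hl.perm.mem_iff.1 hyl
  obtain ⟨a, hay⟩ := exists_infix_pair_left hyl₀ (hfirst .refl)
  obtain ⟨b, hyb⟩ := exists_infix_pair_right hyl₀ hlast
  by_contra! hcon
  -- Otherwise both original neighbours of `y` would be its successor on `l`.
  have succ {c : V} (hc : [c, y] <:+: l₀ ∨ [y, c] <:+: l₀) : [y, c] <:+: l := by
    have hcR : c ∉ rotationEnds G l₀ := fun h ↦ hc.elim (hcon c h).1 (hcon c h).2
    refine (hl.infix_pair hcR hy hc).resolve_left fun hcy ↦ hcR ?_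
    exact eq_of_infix_pair_left hlong.nodup hzy hcy ▸ hz
  obtain rfl := eq_of_infix_pair_right hlong.nodup (succ (.inl hay)) (succ (.inr hyb))
  exact not_infix_pair_swap h₀.nodup hay hyb

open Classical in
/-- The vertices outside `S` that have a neighbour in `S`. -/
noncomputable def outerNeighbors (G : SimpleGraph V) (S : Finset V) : Finset V :=
  {y | y ∉ S ∧ ∃ x ∈ S, G.Adj x y}

lemma mem_outerNeighbors {S : Finset V} :
    y ∈ outerNeighbors G S ↔ y ∉ S ∧ ∃ x ∈ S, G.Adj x y := by
  simp [outerNeighbors]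

open Classical in
/-- Pósa's lemma. -/
lemma IsLongestPathIn.card_outerNeighbors_rotationEnds_le (h₀ : IsLongestPathIn G A l₀) :
    ((outerNeighbors G (rotationEnds G l₀)).filter (· ∈ A)).card ≤
      2 * (rotationEnds G l₀).card + 1 := by
  set R := rotationEnds G l₀
  let after : Finset V := {y | ∃ z ∈ R, [z, y] <:+: l₀}
  let before : Finset V := {y | ∃ z ∈ R, [y, z] <:+: l₀}
  have hafter : after.card ≤ R.card :=
    Finset.card_le_card_of_forall_subsingleton (fun y z ↦ [z, y] <:+: l₀) (by simp [after])
      fun z _ y hy y' hy' ↦ eq_of_infix_pair_right h₀.nodup hy.2 hy'.2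
  have hbefore : before.card ≤ R.card :=
    Finset.card_le_card_of_forall_subsingleton (fun y z ↦ [y, z] <:+: l₀) (by simp [before])
      fun z _ y hy y' hy' ↦ eq_of_infix_pair_left h₀.nodup hy.2 hy'.2
  have hsub : (outerNeighbors G R).filter (· ∈ A) ⊆
      after ∪ before ∪ l₀.getLast?.toFinset := by
    intro y hy
    obtain ⟨hy, hyA⟩ := Finset.mem_filter.1 hy
    obtain ⟨hyR, x, hx, hxy⟩ := mem_outerNeighbors.1 hy
    by_cases hlast : l₀.getLast? = some y
    · simp [hlast]
    · obtain ⟨z, hz, h⟩ := h₀.exists_infix_pair_of_adj hx hyA hyR hxy hlast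
      have : y ∈ after ∨ y ∈ before := h.imp (fun h ↦ by simpa [after] using ⟨z, hz, h⟩)
        fun h ↦ by simpa [before] using ⟨z, hz, h⟩
      exact Finset.mem_union_left _ (Finset.mem_union.2 this)
  have hlast : l₀.getLast?.toFinset.card ≤ 1 := by
    rw [Option.card_toFinset]
    cases l₀.getLast? <;> simp
  have := (Finset.card_le_card hsub).trans (Finset.card_union_le _ _)
  have := Finset.card_union_le after before
  lia

end Rotation

section Expander

variable {V : Type*} [Fintype V] {G G' : SimpleGraph V} {A : Set V} {l l₀ : List V} {k : ℕ}
  {v w x y : V}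

/-- Nonempty sets of at most `k` vertices have at least `2 |S| + 3` outer neighbours. -/
def IsExpander (k : ℕ) (G : SimpleGraph V) : Prop :=
  ∀ S : Finset V, S.Nonempty → S.card ≤ k → 2 * S.card + 3 ≤ (outerNeighbors G S).card

lemma IsExpander.lt_card_rotationEnds (hG : IsExpander k G) (hA : {w}ᶜ ⊆ A)
    (h₀ : IsLongestPathIn G A l₀) (hne : l₀ ≠ []) : k < (rotationEnds G l₀).card := by
  classical
  by_contra! hk
  have hexp := hG _ (rotationEnds_nonempty hne) hk
  have hposa := h₀.card_outerNeighbors_rotationEnds_le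
  have hsub : outerNeighbors G (rotationEnds G l₀) ⊆
      insert w ((outerNeighbors G (rotationEnds G l₀)).filter (· ∈ A)) := fun y hy ↦ by
    by_cases hyw : y = w
    · exact Finset.mem_insert.2 (.inl hyw)
    · exact Finset.mem_insert_of_mem (Finset.mem_filter.2 ⟨hy, hA hyw⟩)
  have := (Finset.card_le_card hsub).trans (Finset.card_insert_le _ _)
  lia

open Classical in
/-- The first vertices of the longest paths that avoid `w`. -/
noncomputable def avoidingEnds (G : SimpleGraph V) (w : V) : Finset V :=
  {x | ∃ l, IsLongestPathIn G {w}ᶜ l ∧ l.head? = some x}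

lemma mem_avoidingEnds :
    x ∈ avoidingEnds G w ↔ ∃ l, IsLongestPathIn G {w}ᶜ l ∧ l.head? = some x := by
  simp [avoidingEnds]

lemma avoidingEnds_congr (h : ∀ u ≠ w, ∀ v ≠ w, (G.Adj u v ↔ G'.Adj u v)) :
    avoidingEnds G w = avoidingEnds G' w := by
  have hpath (l : List V) : IsLongestPathIn G {w}ᶜ l ↔ IsLongestPathIn G' {w}ᶜ l :=
    ⟨.congr h, .congr fun u hu v hv ↦ (h u hu v hv).symm⟩
  ext x
  simp only [mem_avoidingEnds, hpath]

lemma IsExpander.lt_card_avoidingEnds [Nontrivial V] (hG : IsExpander k G) (w : V) :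
    k < (avoidingEnds G w).card := by
  obtain ⟨v, hv⟩ := exists_ne w
  obtain ⟨l₀, h₀⟩ := exists_isLongestPathIn G {w}ᶜ
  refine (hG.lt_card_rotationEnds subset_rfl h₀ (h₀.ne_nil (x := v) hv)).trans_le
    (Finset.card_le_card fun x hx ↦ ?_)
  obtain ⟨l, hl, hlx⟩ := mem_rotationEnds.1 hx
  exact mem_avoidingEnds.2 ⟨l, hl.isLongestPathIn h₀, hlx⟩

/-- A longest path that misses `w` is also longest in the complement of `w`, so `w` cannot be joined
to an end of such a path. -/
lemma IsLongestPathIn.mem_of_forall_exists_adj (hl : IsLongestPathIn G Set.univ l)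
    (h : ∃ x ∈ avoidingEnds G w, G.Adj w x) : w ∈ l := by
  by_contra hw
  obtain ⟨x, hx, hwx⟩ := h
  obtain ⟨l', hl', hx⟩ := mem_avoidingEnds.1 hx
  have hle : l.length ≤ l'.length :=
    hl'.length_le l ⟨hl.nodup, hl.isChain, fun y hy hyw ↦ hw (hyw ▸ hy)⟩
  have huniv : IsPathIn G Set.univ l' := ⟨hl'.nodup, hl'.isChain, by simp⟩
  have hlt := hl.length_le _
    (huniv.cons (Set.mem_univ w) (fun hw' ↦ hl'.mem w hw' rfl) hx hwx)
  rw [List.length_cons] at hlt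
  lia

/-- `G` has a Hamilton path from `x` to `y`. -/
def HasHamiltonPath (G : SimpleGraph V) (x y : V) : Prop :=
  ∃ l : List V, l.Nodup ∧ (∀ u, u ∈ l) ∧ l.IsChain G.Adj ∧ l.head? = some x ∧ l.getLast? = some y

open Classical in
lemma IsLongestPathIn.hasHamiltonPath (hl : IsLongestPathIn G Set.univ l)
    (h : ∀ w, ∃ x ∈ avoidingEnds G w, G.Adj w x) (hx : l.head? = some x)
    (hy : l.getLast? = some y) : HasHamiltonPath G x y :=
  ⟨l, hl.nodup, fun w ↦ hl.mem_of_forall_exists_adj (h w), hl.isChain, hx, hy⟩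

open Classical in
lemma IsExpander.lt_card_hasHamiltonPath [Nonempty V] (hG : IsExpander k G)
    (h : ∀ w, ∃ x ∈ avoidingEnds G w, G.Adj w x) :
    k < (Finset.univ.filter fun y ↦
      k < (Finset.univ.filter fun x ↦ HasHamiltonPath G x y).card).card := by
  obtain ⟨v⟩ := ‹Nonempty V›
  have lt_card_rotationEnds {l : List V} (hl : IsLongestPathIn G Set.univ l) :
      k < (rotationEnds G l).card :=
    hG.lt_card_rotationEnds (w := v) (Set.subset_univ _) hl (hl.ne_nil (Set.mem_univ v))
  obtain ⟨l₀, h₀⟩ := exists_isLongestPathIn G Set.univ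
  refine (lt_card_rotationEnds h₀).trans_le (Finset.card_le_card fun y hy ↦ ?_)
  obtain ⟨l, hl, hly⟩ := mem_rotationEnds.1 hy
  have hrev := (hl.isLongestPathIn h₀).reverse
  simp only [Finset.mem_filter, Finset.mem_univ, true_and]
  refine (lt_card_rotationEnds hrev).trans_le (Finset.card_le_card fun x hx ↦ ?_)
  obtain ⟨l', hl', hlx⟩ := mem_rotationEnds.1 hx
  simp only [Finset.mem_filter, Finset.mem_univ, true_and]
  exact (hl'.isLongestPathIn hrev).hasHamiltonPath h hlx
    (by rw [hl'.getLast?, List.getLast?_reverse, hly])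

end Expander

section Transitive

variable {V W : Type*}

/-- The orbit of every point under the iterates of `s` is everything: a transitive permutation is a
single cycle through all points. -/
def IsTransitive (s : V → V) : Prop :=
  ∀ u v, ∃ t : ℕ, s^[t] u = v

lemma IsTransitive.conj {s : V → V} (hs : IsTransitive s) {s' : W → W} (e : V ≃ W)
    (h : Function.Semiconj e s s') : IsTransitive s' := fun u v ↦ by
  obtain ⟨t, ht⟩ := hs (e.symm u) (e.symm v)
  exact ⟨t, by rw [← e.apply_symm_apply u, ← h.iterate_right t, ht, e.apply_symm_apply]⟩

/-- The digraph with adjacency relation `S` has a directed Hamilton cycle, given by the permutation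
that maps every vertex to the next one. -/
def HasHamiltonCycle (S : V → V → Prop) : Prop :=
  ∃ π : Equiv.Perm V, IsTransitive π ∧ ∀ x, S x (π x)

lemma hasHamiltonCycle_of_isChain {S : V → V → Prop} {a : V} {l : List V} (hl : (a :: l).Nodup)
    (hmem : ∀ v, v ∈ a :: l) (hS : (a :: l ++ [a]).IsChain S) : HasHamiltonCycle S := by
  classical
  refine ⟨(a :: l).formPerm, fun u v ↦ ?_, fun u ↦ ?_⟩
  · obtain ⟨t, ht⟩ := hl.isCycleOn_formPerm.exists_pow_eq' (List.finite_toSet _) (hmem u) (hmem v)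
    exact ⟨t, by rwa [Equiv.Perm.iterate_eq_pow]⟩
  · obtain ⟨i, hi, rfl⟩ := List.getElem_of_mem (hmem u)
    have hstep := List.isChain_iff_getElem.1 hS i (by simpa using hi)
    rw [List.getElem_append_left hi] at hstep
    rw [List.formPerm_apply_getElem _ hl]
    rcases Nat.lt_or_ge (i + 1) (a :: l).length with hi' | hi'
    · rw [List.getElem_append_left hi'] at hstep
      simpa only [Nat.mod_eq_of_lt hi'] using hstep
    · obtain hi' : i + 1 = (a :: l).length := by lia
      simpa [hi'] using hstep

lemma injOn_sym2Mk_of_isTransitive [Fintype V] {π : Equiv.Perm V} (hπ : IsTransitive π)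
    (hV : 2 < Fintype.card V) : Set.InjOn (fun e : V × V ↦ s(e.1, e.2)) {e | e.2 = π e.1} := by
  classical
  rintro ⟨x, x'⟩ hx ⟨y, y'⟩ hy h
  obtain rfl : x' = π x := hx
  obtain rfl : y' = π y := hy
  rcases Sym2.eq_iff.1 h with ⟨hxy, -⟩ | ⟨hxy, hyx⟩
  · dsimp only at hxy
    rw [hxy]
  -- The orbit of `x` would be `{x, y}`.
  have horbit (t : ℕ) : π^[t] x ∈ ({x, y} : Finset V) := by
    induction t with
    | zero => simp
    | succ t ih =>
      rw [Function.iterate_succ_apply']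
      rcases Finset.mem_insert.1 ih with h | h <;> simp_all
  have hle : Fintype.card V ≤ ({x, y} : Finset V).card :=
    Finset.card_le_card fun v _ ↦ by
      obtain ⟨t, rfl⟩ := hπ x v
      exact horbit t
  exact absurd (hle.trans Finset.card_le_two) hV.not_ge

end Transitive

section Coupling

variable {Ω β : Type*} [MeasurableSpace Ω] {μ : Measure Ω} [IsProbabilityMeasure μ]

lemma measureReal_diag_le {P Q : Ω → Prop} {W : Prop → Prop → Prop}
    (hPQ : μ.real {ω | P ω} = μ.real {ω | Q ω})
    (hmono : ∀ s s' t t', (s → s') → (t → t') → W s t → W s' t')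
    (hsplit : W True True → W True False ∨ W False True) :
    μ.real {ω | W (P ω) (P ω)} ≤ μ.real {ω | W (P ω) (Q ω)} := by
  by_cases hF : W False False
  · exact measureReal_mono fun ω _ ↦ hmono _ _ _ _ False.elim False.elim hF
  have hdiag : {ω | W (P ω) (P ω)} ⊆ {ω | P ω} := fun ω hω ↦ by
    by_contra hP
    exact hF (hmono _ _ _ _ hP hP hω)
  by_cases hT : W True True
  · rcases hsplit hT with hTF | hFT
    · exact measureReal_mono fun ω hω ↦
        hmono _ _ _ _ (fun _ ↦ hdiag hω) False.elim hTF
    · calc μ.real {ω | W (P ω) (P ω)} ≤ μ.real {ω | Q ω} := hPQ ▸ measureReal_mono hdiag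
        _ ≤ μ.real {ω | W (P ω) (Q ω)} :=
          measureReal_mono fun ω hω ↦ hmono _ _ _ _ False.elim (fun _ ↦ hω) hFT
  · have : {ω | W (P ω) (P ω)} = ∅ := Set.eq_empty_of_forall_notMem fun ω hω ↦
      hT (hmono _ _ _ _ (fun _ ↦ trivial) (fun _ ↦ trivial) hω)
    simp [this]

variable [Finite β] {ξ : β → Ω → Prop} {q : ℝ} {𝓒 : Set (Set β)}

/-- One step of McDiarmid's coupling: the element `b`, which copies the coordinate `r b`, gets a
coordinate of its own. -/
lemma IsBernoulliFamily.measureReal_exists_forall_le_update [DecidableEq β]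
    (h : IsBernoulliFamily ξ q μ) {r : β → β} {b : β} (hb : ∀ e, r e ≠ b)
    (hr : ∀ C ∈ 𝓒, b ∈ C → ∀ e ∈ C, r e = r b → e = b) :
    μ.real {ω | ∃ C ∈ 𝓒, ∀ e ∈ C, ξ (r e) ω} ≤
      μ.real {ω | ∃ C ∈ 𝓒, ∀ e ∈ C, ξ (Function.update r b b e) ω} := by
  let E (r : β → β) : Set (β → Prop) := {f | ∃ C ∈ 𝓒, ∀ e ∈ C, f (r e)}
  refine measureReal_mono_of_piecewise_le h.indep h.measurable {r b, b} (E := E r)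
    (E' := E (Function.update r b b)) (Set.toFinite _).measurableSet
    (Set.toFinite _).measurableSet fun f ↦ ?_
  let W (s t : Prop) : Prop :=
    ∃ C ∈ 𝓒, ∀ e ∈ C, if e = b then t else if r e = r b then s else f (r e)
  have hmono (s s' t t' : Prop) (hs : s → s') (ht : t → t') : W s t → W s' t' := by
    rintro ⟨C, hC, h⟩
    refine ⟨C, hC, fun e he ↦ ?_⟩
    have := h e he
    split_ifs at this ⊢ <;> tauto
  have hsplit : W True True → W True False ∨ W False True := by
    rintro ⟨C, hC, h⟩
    by_cases hbC : b ∈ C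
    · refine .inr ⟨C, hC, fun e he ↦ ?_⟩
      have := h e he
      have := hr C hC hbC e he
      split_ifs <;> simp_all
    · refine .inl ⟨C, hC, fun e he ↦ ?_⟩
      have := h e he
      have : e ≠ b := fun heb ↦ hbC (heb ▸ he)
      split_ifs <;> simp_all
  have hE (ω : Ω) : ({r b, b} : Set β).piecewise (fun b ↦ ξ b ω) f ∈ E r ↔
      W (ξ (r b) ω) (ξ (r b) ω) := by
    refine exists_congr fun C ↦ and_congr_right fun _ ↦ forall₂_congr fun e _ ↦ ?_
    by_cases heb : e = b
    · simp [heb]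
    · by_cases her : r e = r b <;> simp [heb, her, hb]
  have hE' (ω : Ω) : ({r b, b} : Set β).piecewise (fun b ↦ ξ b ω) f ∈
      E (Function.update r b b) ↔ W (ξ (r b) ω) (ξ b ω) := by
    refine exists_congr fun C ↦ and_congr_right fun _ ↦ forall₂_congr fun e _ ↦ ?_
    by_cases heb : e = b
    · simp [heb]
    · by_cases her : r e = r b <;> simp [heb, her, hb]
  simp only [hE, hE']
  exact measureReal_diag_le ((h.prob _).trans (h.prob _).symm) hmono hsplit

/-- McDiarmid's coupling: the coordinates identified by `ρ` are made independent one at a time. -/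
lemma IsBernoulliFamily.measureReal_exists_forall_le (h : IsBernoulliFamily ξ q μ) {ρ : β → β}
    (hρ : ∀ e, ρ (ρ e) = ρ e) (h𝓒 : ∀ C ∈ 𝓒, Set.InjOn ρ C) :
    μ.real {ω | ∃ C ∈ 𝓒, ∀ e ∈ C, ξ (ρ e) ω} ≤ μ.real {ω | ∃ C ∈ 𝓒, ∀ e ∈ C, ξ e ω} := by
  classical
  have := Fintype.ofFinite β
  have hT (T : Finset β) : (∀ b ∈ T, ρ b ≠ b) → μ.real {ω | ∃ C ∈ 𝓒, ∀ e ∈ C, ξ (ρ e) ω} ≤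
      μ.real {ω | ∃ C ∈ 𝓒, ∀ e ∈ C, ξ (T.piecewise id ρ e) ω} := by
    induction T using Finset.induction_on with
    | empty => simp
    | insert b T hbT ih =>
      intro hT
      obtain ⟨hb, hT⟩ := Finset.forall_mem_insert .. |>.1 hT
      refine (ih hT).trans ?_
      rw [Finset.piecewise_insert]
      refine h.measureReal_exists_forall_le_update (fun e heb ↦ ?_) fun C hC hbC e he heb ↦ ?_
      · by_cases heT : e ∈ T
        · exact hbT (by simp_all)
        · exact hb (by rw [← heb]; simp [heT, hρ])
      · refine h𝓒 C hC he hbC ?_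
        by_cases heT : e ∈ T <;> simp_all
  have hid (e : β) : ({b | ρ b ≠ b} : Finset β).piecewise id ρ e = e := by
    by_cases he : ρ e = e <;> simp [he]
  simpa only [hid] using hT {b | ρ b ≠ b} (by simp)

variable {V : Type*} [Fintype V]

lemma IsBernoulliFamily.measureReal_hasHamiltonCycle_sym2_le {ξ : V × V → Ω → Prop}
    (h : IsBernoulliFamily ξ q μ) (hV : 2 < Fintype.card V) :
    μ.real {ω | HasHamiltonCycle fun x y ↦ ξ (Quot.out s(x, y)) ω} ≤
      μ.real {ω | HasHamiltonCycle fun x y ↦ ξ (x, y) ω} := by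
  classical
  let 𝓒 : Set (Set (V × V)) := {C | ∃ π : Equiv.Perm V, IsTransitive π ∧ C = {e | e.2 = π e.1}}
  have h𝓒 (ζ : V × V → Prop) :
      (∃ C ∈ 𝓒, ∀ e ∈ C, ζ e) ↔ HasHamiltonCycle fun x y ↦ ζ (x, y) := by
    simp [𝓒, HasHamiltonCycle]
  simpa only [h𝓒] using h.measureReal_exists_forall_le (𝓒 := 𝓒)
    (ρ := fun e ↦ Quot.out s(e.1, e.2)) (fun e ↦ congr_arg Quot.out (Quot.out_eq _)) (by
      rintro _ ⟨π, hπ, rfl⟩ e he e' he' hee'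
      exact injOn_sym2Mk_of_isTransitive hπ hV he he'
        (Function.LeftInverse.injective Quot.out_eq hee'))

end Coupling

section RandomGraph

variable {U Ω : Type*} [MeasurableSpace Ω] {μ : Measure Ω} {ξ : Sym2 U → Ω → Prop} {q : ℝ}
  {k n : ℕ}

/-- The graph whose edges are the non-diagonal pairs satisfying `f`; the random graph `G(U, q)` is
`edgeGraph` of a Bernoulli family. -/
def edgeGraph (f : Sym2 U → Prop) : SimpleGraph U :=
  .fromEdgeSet {z | f z}

lemma edgeGraph_adj {f : Sym2 U → Prop} {u v : U} :
    (edgeGraph f).Adj u v ↔ f s(u, v) ∧ u ≠ v := by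
  simp [edgeGraph]

lemma exp_neg_le_inv_pow (hn : 0 < n) {j : ℕ} {x : ℝ} (hx : j * Real.log n ≤ x) :
    Real.exp (-x) ≤ ((n : ℝ) ^ j)⁻¹ := by
  have hn' : (0 : ℝ) < n := by exact_mod_cast hn
  calc Real.exp (-x) ≤ Real.exp (-(j * Real.log n)) := Real.exp_le_exp.2 (by linarith)
    _ = ((n : ℝ) ^ j)⁻¹ := by rw [Real.exp_neg, Real.exp_nat_mul, Real.exp_log hn']

lemma IsBernoulliFamily.measureReal_forall_not_adj_le [IsProbabilityMeasure μ]
    (h : IsBernoulliFamily ξ q μ)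
    {S T : Finset U} (hST : Disjoint S T) {c : ℕ} (hc : c ≤ S.card * T.card) :
    μ.real {ω | ∀ x ∈ S, ∀ y ∈ T, ¬ (edgeGraph (ξ · ω)).Adj x y} ≤ Real.exp (-(q * c)) := by
  classical
  have hinj : Set.InjOn (fun e : U × U ↦ s(e.1, e.2)) (S ×ˢ T : Finset (U × U)) := by
    rintro ⟨x, y⟩ hxy ⟨x', y'⟩ hxy' heq
    simp only [Finset.coe_product, Set.mem_prod, Finset.mem_coe] at hxy hxy'
    rcases Sym2.eq_iff.1 heq with ⟨h₁, h₂⟩ | ⟨h₁, -⟩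
    · exact Prod.ext h₁ h₂
    · exact absurd h₁ (Finset.disjoint_iff_ne.1 hST x hxy.1 y' hxy'.2)
  have hcard : c ≤ ((S ×ˢ T).image fun e ↦ s(e.1, e.2)).card := by
    rwa [Finset.card_image_of_injOn hinj, Finset.card_product]
  refine (measureReal_mono fun ω hω ↦ ?_).trans (h.measureReal_forall_not_le hcard)
  simp only [Set.mem_ofPred_eq, edgeGraph_adj] at hω
  simp only [Set.mem_ofPred_eq, Finset.forall_mem_image, Finset.mem_product]
  rintro ⟨x, y⟩ ⟨hx, hy⟩ hxy
  exact hω x hx y hy ⟨hxy, fun h ↦ Finset.disjoint_left.1 hST hx (h ▸ hy)⟩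

variable [Fintype U]

lemma measureReal_biUnion_powersetCard_le [IsFiniteMeasure μ] (hn : 0 < n)
    (hUn : Fintype.card U ≤ n) {s t c j : ℕ} (hj : s + t + c ≤ j)
    {A : Finset U × Finset U → Set Ω}
    (hA : ∀ p ∈ Finset.univ.powersetCard s ×ˢ Finset.univ.powersetCard t,
      μ.real (A p) ≤ ((n : ℝ) ^ j)⁻¹) :
    μ.real (⋃ p ∈ Finset.univ.powersetCard s ×ˢ Finset.univ.powersetCard t, A p) ≤
      ((n : ℝ) ^ c)⁻¹ := by
  have hn' : (1 : ℝ) ≤ n := by exact_mod_cast hn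
  set P : Finset (Finset U × Finset U) := Finset.univ.powersetCard s ×ˢ Finset.univ.powersetCard t
  have hcard : P.card ≤ n ^ (s + t) := by
    calc P.card = (Fintype.card U).choose s * (Fintype.card U).choose t := by simp [P]
      _ ≤ n ^ s * n ^ t := by
        gcongr <;> exact (Nat.choose_le_pow _ _).trans (Nat.pow_le_pow_left hUn _)
      _ = n ^ (s + t) := (pow_add n s t).symm
  calc μ.real (⋃ p ∈ P, A p) ≤ ∑ p ∈ P, μ.real (A p) := measureReal_biUnion_finset_le _ _
    _ ≤ P.card • ((n : ℝ) ^ j)⁻¹ := Finset.sum_le_card_nsmul _ _ _ hA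
    _ ≤ (n : ℝ) ^ (s + t) * ((n : ℝ) ^ j)⁻¹ := by
        rw [nsmul_eq_mul]
        gcongr
        exact_mod_cast hcard
    _ ≤ ((n : ℝ) ^ c)⁻¹ := by
        rw [← div_eq_mul_inv, div_le_iff₀ (by positivity), inv_mul_eq_div,
          le_div_iff₀ (by positivity), ← pow_add]
        exact pow_le_pow_right₀ hn' hj

open Classical in
lemma exists_forall_not_adj_of_not_isExpander {G : SimpleGraph U} (hG : ¬ IsExpander k G)
    (hk : 2 * k + 2 ≤ Fintype.card U) :
    ∃ S T : Finset U, S.card ∈ Finset.Icc 1 k ∧ T.card = 2 * S.card + 2 ∧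
      ∀ x ∈ S, ∀ y ∈ (S ∪ T)ᶜ, ¬ G.Adj x y := by
  simp only [IsExpander, not_forall, not_le] at hG
  obtain ⟨S, hS, hSk, hlt⟩ := hG
  obtain ⟨T, hT, hTcard⟩ := Finset.exists_superset_card_eq (n := 2 * S.card + 2)
    (Nat.lt_succ_iff.1 hlt) (by lia)
  refine ⟨S, T, Finset.mem_Icc.2 ⟨hS.card_pos, hSk⟩, hTcard, fun x hx y hy hxy ↦ ?_⟩
  simp only [Finset.mem_compl, Finset.mem_union, not_or] at hy
  exact hy.2 (hT (mem_outerNeighbors.2 ⟨hy.1, x, hx, hxy⟩))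

variable [IsProbabilityMeasure μ]

/-- The set `avoidingEnds G w` does not depend on the edges at `w`, so it may be frozen first. -/
lemma IsBernoulliFamily.measureReal_forall_avoidingEnds_not_adj_le (h : IsBernoulliFamily ξ q μ)
    (w : U) :
    μ.real {ω | k < (avoidingEnds (edgeGraph (ξ · ω)) w).card ∧
      ∀ x ∈ avoidingEnds (edgeGraph (ξ · ω)) w, ¬ (edgeGraph (ξ · ω)).Adj w x} ≤
      Real.exp (-(q * (k + 1 : ℕ))) := by
  classical
  refine measureReal_le_of_piecewise_le h.indep h.measurable {z | w ∈ z}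
    (E := {f | k < (avoidingEnds (edgeGraph f) w).card ∧
      ∀ x ∈ avoidingEnds (edgeGraph f) w, ¬ (edgeGraph f).Adj w x})
    (Set.toFinite _).measurableSet fun f ↦ ?_
  have hends (ω : Ω) : avoidingEnds (edgeGraph ({z | w ∈ z}.piecewise (ξ · ω) f)) w =
      avoidingEnds (edgeGraph f) w := by
    refine avoidingEnds_congr fun u hu v hv ↦ ?_
    simp [edgeGraph_adj, hu.symm, hv.symm]
  have hmem {x : U} (hx : x ∈ avoidingEnds (edgeGraph f) w) : w ≠ x := by
    obtain ⟨l, hl, hlx⟩ := mem_avoidingEnds.1 hx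
    rintro rfl
    exact hl.mem w (List.mem_of_mem_head? hlx) rfl
  by_cases hk : k < (avoidingEnds (edgeGraph f) w).card
  · refine (measureReal_mono fun ω hω ↦ ?_).trans (h.measureReal_forall_not_adj_le (S := {w})
      (T := avoidingEnds (edgeGraph f) w) (c := k + 1) (by simpa using fun hw ↦ hmem hw rfl)
      (by simpa using hk))
    simpa [hends, edgeGraph_adj] using hω.2
  · simp [hends, hk, Real.exp_nonneg]

lemma IsBernoulliFamily.measureReal_forall_not_adj_compl_le [DecidableEq U]
    (h : IsBernoulliFamily ξ q μ) (hn : 0 < n) (hU : 16 ≤ Fintype.card U) {S T : Finset U}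
    (hS : 8 * S.card ≤ Fintype.card U) (hT : T.card = 2 * S.card + 2)
    (hq : 32 * Real.log n ≤ q * Fintype.card U) :
    μ.real {ω | ∀ x ∈ S, ∀ y ∈ (S ∪ T)ᶜ, ¬ (edgeGraph (ξ · ω)).Adj x y} ≤
      ((n : ℝ) ^ (16 * S.card))⁻¹ := by
  obtain ⟨u⟩ : Nonempty U := Fintype.card_pos_iff.1 (by lia)
  have : Nonempty (Sym2 U) := ⟨s(u, u)⟩
  have hq₀ : 0 ≤ q := h.nonneg
  let r := Fintype.card U - (3 * S.card + 2)
  have hr : r ≤ ((S ∪ T)ᶜ).card := by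
    rw [Finset.card_compl]
    have := Finset.card_union_le S T
    lia
  refine (h.measureReal_forall_not_adj_le (disjoint_compl_right.mono_left Finset.subset_union_left)
    (Nat.mul_le_mul_left _ hr)).trans (exp_neg_le_inv_pow hn ?_)
  have hhalf : (Fintype.card U : ℝ) ≤ 2 * r := by exact_mod_cast (by lia : Fintype.card U ≤ 2 * r)
  have hlog : 16 * Real.log n ≤ q * r := by nlinarith
  push_cast
  linarith [mul_le_mul_of_nonneg_left hlog (Nat.cast_nonneg S.card : (0 : ℝ) ≤ S.card)]

/-- A non-expanding set `S` of size `s`, with its outer neighbourhood padded to size `2 s + 2`,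
leaves `s * (card U - 3 s - 2)` non-edges, which beats the `n ^ (3 s + 2)` choices of the two
sets. -/
lemma IsBernoulliFamily.measureReal_not_isExpander_le (h : IsBernoulliFamily ξ q μ)
    (hU : 16 ≤ Fintype.card U) (hUn : Fintype.card U ≤ n) (hk : 8 * k ≤ Fintype.card U)
    (hq : 32 * Real.log n ≤ q * Fintype.card U) :
    μ.real {ω | ¬ IsExpander k (edgeGraph (ξ · ω))} ≤ ((n : ℝ) ^ 3)⁻¹ := by
  classical
  have hn : (1 : ℝ) ≤ n := by exact_mod_cast (by lia : 1 ≤ n)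
  let pairs (s : ℕ) : Finset (Finset U × Finset U) :=
    Finset.univ.powersetCard s ×ˢ Finset.univ.powersetCard (2 * s + 2)
  let noEdge (p : Finset U × Finset U) : Set Ω :=
    {ω | ∀ x ∈ p.1, ∀ y ∈ (p.1 ∪ p.2)ᶜ, ¬ (edgeGraph (ξ · ω)).Adj x y}
  have hsub : {ω | ¬ IsExpander k (edgeGraph (ξ · ω))} ⊆
      ⋃ s ∈ Finset.Icc 1 k, ⋃ p ∈ pairs s, noEdge p := by
    intro ω hω
    obtain ⟨S, T, hS, hT, hST⟩ := exists_forall_not_adj_of_not_isExpander hω (by lia)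
    simp only [Set.mem_iUnion]
    exact ⟨S.card, hS, (S, T), by simp [pairs, hT], by simpa [noEdge] using hST⟩
  have hnoEdge {s : ℕ} (hs : s ∈ Finset.Icc 1 k) : ∀ p ∈ pairs s,
      μ.real (noEdge p) ≤ ((n : ℝ) ^ (16 * s))⁻¹ := by
    rintro ⟨S, T⟩ hST
    obtain ⟨rfl, hT⟩ : S.card = s ∧ T.card = 2 * s + 2 := by simpa [pairs] using hST
    have hSk := (Finset.mem_Icc.1 hs).2
    exact h.measureReal_forall_not_adj_compl_le (by lia) hU (by lia) hT hq
  have hpairs {s : ℕ} (hs : s ∈ Finset.Icc 1 k) :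
      μ.real (⋃ p ∈ pairs s, noEdge p) ≤ ((n : ℝ) ^ 4)⁻¹ := by
    have hs₁ := (Finset.mem_Icc.1 hs).1
    exact measureReal_biUnion_powersetCard_le (by lia) hUn (by lia) (hnoEdge hs)
  have hkn : (k : ℝ) ≤ n := by exact_mod_cast (by lia : k ≤ n)
  calc μ.real {ω | ¬ IsExpander k (edgeGraph (ξ · ω))}
      ≤ ∑ s ∈ Finset.Icc 1 k, μ.real (⋃ p ∈ pairs s, noEdge p) :=
        (measureReal_mono hsub (measure_ne_top _ _)).trans (measureReal_biUnion_finset_le _ _)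
    _ ≤ k * ((n : ℝ) ^ 4)⁻¹ := by
        simpa using Finset.sum_le_card_nsmul _ _ _ fun s hs ↦ hpairs hs
    _ ≤ n * ((n : ℝ) ^ 4)⁻¹ := by gcongr
    _ = ((n : ℝ) ^ 3)⁻¹ := by field_simp

end RandomGraph

section RandomHamilton

variable {U Ω : Type*} [MeasurableSpace Ω] {μ : Measure Ω} [IsProbabilityMeasure μ]
  {η : Sym2 (Option U) → Ω → Prop} {q : ℝ} {k n : ℕ}

lemma HasHamiltonPath.hasHamiltonCycle {f : Sym2 (Option U) → Prop} {x y : U}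
    (h : HasHamiltonPath (edgeGraph fun z ↦ f (z.map some)) x y) (hx : f s(none, some x))
    (hy : f s(some y, none)) : HasHamiltonCycle fun u v ↦ f s(u, v) := by
  obtain ⟨l, hl, hmem, hchain, hlx, hly⟩ := h
  refine hasHamiltonCycle_of_isChain (a := none) (l := l.map some) ?_ ?_ ?_
  · exact List.nodup_cons.2 ⟨by simp, hl.map (Option.some_injective _)⟩
  · rintro (_ | u) <;> simp [hmem]
  · have hmap : (l.map some).IsChain fun u v ↦ f s(u, v) :=
      (List.isChain_map _).2 (hchain.imp fun u v huv ↦ by simpa using (edgeGraph_adj.1 huv).1)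
    refine (hmap.append (.singleton none) ?_).cons ?_
    · simpa [hly] using hy
    · cases l <;> simp_all

variable [Fintype U]

lemma IsBernoulliFamily.measureReal_forall_not_close_le
    (h : IsBernoulliFamily η q μ) {R : Finset U} (hR : k < R.card) {R' : U → Finset U}
    (hR' : ∀ y ∈ R, k < (R' y).card) :
    μ.real {ω | ∀ y ∈ R, ∀ x ∈ R' y, ¬ (η s(none, some x) ω ∧ η s(some y, none) ω)} ≤
      (Fintype.card U + 1) * Real.exp (-(q * (k + 1 : ℕ))) := by
  let isolated (s : Finset U) : Set Ω := {ω | ∀ x ∈ s, ¬ η s(none, some x) ω}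
  have hisolated {s : Finset U} (hs : k < s.card) :
      μ.real (isolated s) ≤ Real.exp (-(q * (k + 1 : ℕ))) :=
    (h.precomp (g := fun x ↦ s(none, some x)) fun x y hxy ↦ by
      simpa using hxy).measureReal_forall_not_le hs
  have hsub : {ω | ∀ y ∈ R, ∀ x ∈ R' y, ¬ (η s(none, some x) ω ∧ η s(some y, none) ω)} ⊆
      isolated R ∪ ⋃ y ∈ R, isolated (R' y) := by
    intro ω hω
    by_cases hR : ω ∈ isolated R
    · exact .inl hR
    · obtain ⟨y, hy, hyω⟩ : ∃ y ∈ R, η s(none, some y) ω := by simpa [isolated] using hR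
      refine .inr (Set.mem_iUnion₂.2 ⟨y, hy, fun x hx hxω ↦ hω y hy x hx ⟨hxω, ?_⟩⟩)
      rwa [Sym2.eq_swap]
  calc _ ≤ μ.real (isolated R) + ∑ y ∈ R, μ.real (isolated (R' y)) :=
        (measureReal_mono hsub).trans ((measureReal_union_le _ _).trans
          (by gcongr; exact measureReal_biUnion_finset_le _ _))
    _ ≤ Real.exp (-(q * (k + 1 : ℕ))) + R.card * Real.exp (-(q * (k + 1 : ℕ))) := by
        gcongr
        · exact hisolated hR
        · simpa using Finset.sum_le_card_nsmul _ _ _ fun y hy ↦ hisolated (hR' y hy)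
    _ = (R.card + 1) * Real.exp (-(q * (k + 1 : ℕ))) := by ring
    _ ≤ (Fintype.card U + 1) * Real.exp (-(q * (k + 1 : ℕ))) := by
        gcongr
        exact Finset.card_le_univ R

open Classical in
/-- The vertex `none` is added at the end, so that the Hamilton paths of the graph on `U` are frozen
before the edges closing one of them are exposed. -/
lemma IsBernoulliFamily.measureReal_not_close_le
    (h : IsBernoulliFamily η q μ) :
    μ.real {ω | (k < (Finset.univ.filter fun y ↦ k < (Finset.univ.filter fun x ↦
      HasHamiltonPath (edgeGraph fun z ↦ η (z.map some) ω) x y).card).card) ∧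
        ¬ HasHamiltonCycle fun u v ↦ η s(u, v) ω} ≤
      (Fintype.card U + 1) * Real.exp (-(q * (k + 1 : ℕ))) := by
  refine measureReal_le_of_piecewise_le h.indep h.measurable {z | none ∈ z}
    (E := {f | (k < (Finset.univ.filter fun y ↦ k < (Finset.univ.filter fun x ↦
      HasHamiltonPath (edgeGraph fun z ↦ f (z.map some)) x y).card).card) ∧
        ¬ HasHamiltonCycle fun u v ↦ f s(u, v)})
    (Set.toFinite _).measurableSet fun f ↦ ?_
  let G := edgeGraph fun z : Sym2 U ↦ f (z.map some)
  have hG (ω : Ω) : edgeGraph (fun z : Sym2 U ↦ {z | none ∈ z}.piecewise (η · ω) f (z.map some)) =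
      G := by
    congr 1
    ext z
    simp
  simp only [Set.mem_ofPred_eq, hG]
  let R' (y : U) : Finset U := {x | HasHamiltonPath G x y}
  let R : Finset U := {y | k < (R' y).card}
  by_cases hR : k < R.card
  · refine (measureReal_mono fun ω hω y hy x hx hω' ↦ ?_).trans
      (h.measureReal_forall_not_close_le (R' := R') hR fun y hy ↦ by simpa [R] using hy)
    refine hω.2 (HasHamiltonPath.hasHamiltonCycle (x := x) (y := y) ?_ ?_ ?_)
    · simpa [hG, R'] using hx
    · simpa using hω'.1
    · simpa using hω'.2
  · have hzero : {ω | k < R.card ∧ ¬ HasHamiltonCycle fun u v ↦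
        {z | none ∈ z}.piecewise (η · ω) f s(u, v)} = ∅ := by simp [hR]
    rw [hzero, measureReal_empty]
    positivity

lemma IsBernoulliFamily.measureReal_not_hasHamiltonCycle_sym2_le (h : IsBernoulliFamily η q μ)
    (hU : 16 ≤ Fintype.card U) (hUn : Fintype.card U ≤ n)
    (hq : 32 * Real.log n ≤ q * Fintype.card U) :
    μ.real {ω | ¬ HasHamiltonCycle fun x y ↦ η s(x, y) ω} ≤ 4 * ((n : ℝ) ^ 3)⁻¹ := by
  classical
  have hn : (1 : ℝ) ≤ n := by exact_mod_cast (by lia : 1 ≤ n)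
  have : Nontrivial U := Fintype.one_lt_card_iff_nontrivial.1 (by lia)
  let k := Fintype.card U / 8
  have hexp : Real.exp (-(q * (k + 1 : ℕ))) ≤ ((n : ℝ) ^ 4)⁻¹ := by
    have hk : (Fintype.card U : ℝ) ≤ 8 * (k + 1 : ℕ) := by
      exact_mod_cast (by lia : Fintype.card U ≤ 8 * (k + 1))
    have hq₀ : 0 ≤ q := h.nonneg
    refine exp_neg_le_inv_pow (by lia) ?_
    push_cast at hk ⊢
    nlinarith
  have hmap : IsBernoulliFamily (fun z : Sym2 U ↦ η (z.map some)) q μ :=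
    h.precomp (Sym2.map.injective (Option.some_injective U))
  let G (ω : Ω) : SimpleGraph U := edgeGraph fun z ↦ η (z.map some) ω
  let stuck (w : U) : Set Ω :=
    {ω | k < (avoidingEnds (G ω) w).card ∧ ∀ x ∈ avoidingEnds (G ω) w, ¬ (G ω).Adj w x}
  let unclosed : Set Ω := {ω | (k < (Finset.univ.filter fun y ↦ k < (Finset.univ.filter fun x ↦
    HasHamiltonPath (G ω) x y).card).card) ∧ ¬ HasHamiltonCycle fun u v ↦ η s(u, v) ω}
  have hsub : {ω | ¬ HasHamiltonCycle fun x y ↦ η s(x, y) ω} ⊆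
      ({ω | ¬ IsExpander k (G ω)} ∪ ⋃ w, stuck w) ∪ unclosed := by
    intro ω hω
    by_cases hG : IsExpander k (G ω)
    · by_cases hω' : ω ∈ ⋃ w, stuck w
      · exact .inl (.inr hω')
      · refine .inr ⟨hG.lt_card_hasHamiltonPath fun w ↦ ?_, hω⟩
        by_contra! hw
        exact hω' (Set.mem_iUnion.2 ⟨w, hG.lt_card_avoidingEnds w, hw⟩)
    · exact .inl (.inl hG)
  calc μ.real {ω | ¬ HasHamiltonCycle fun x y ↦ η s(x, y) ω}
      ≤ μ.real {ω | ¬ IsExpander k (G ω)} + μ.real (⋃ w, stuck w) + μ.real unclosed :=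
        (measureReal_mono hsub).trans ((measureReal_union_le _ _).trans
          (by gcongr; exact measureReal_union_le _ _))
    _ ≤ ((n : ℝ) ^ 3)⁻¹ + Fintype.card U * Real.exp (-(q * (k + 1 : ℕ))) +
          (Fintype.card U + 1) * Real.exp (-(q * (k + 1 : ℕ))) := by
        gcongr
        · exact hmap.measureReal_not_isExpander_le hU hUn (by lia) hq
        · refine (measureReal_iUnion_fintype_le _).trans ?_
          simpa using Finset.sum_le_card_nsmul Finset.univ _ _ fun w _ ↦
            hmap.measureReal_forall_avoidingEnds_not_adj_le (k := k) w
        · convert h.measureReal_not_close_le (k := k)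
    _ ≤ ((n : ℝ) ^ 3)⁻¹ + n * ((n : ℝ) ^ 4)⁻¹ + (n + n) * ((n : ℝ) ^ 4)⁻¹ := by gcongr
    _ = 4 * ((n : ℝ) ^ 3)⁻¹ := by field_simp; norm_num

/-- Contracting `σ` turns the random bipartite graph into a random digraph. -/
lemma IsBernoulliFamily.measureReal_not_exists_isTransitive_le {V : Type*} [Fintype V]
    {ξ : V × V → Ω → Prop} (h : IsBernoulliFamily ξ q μ) (hV : 17 ≤ Fintype.card V)
    (hVn : Fintype.card V ≤ n) (hq : 64 * Real.log n ≤ q * Fintype.card V)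
    (σ : Equiv.Perm V) :
    μ.real {ω | ¬ ∃ τ : Equiv.Perm V, (∀ x, ξ (x, τ x) ω) ∧ IsTransitive (τ * σ)} ≤
      4 * ((n : ℝ) ^ 3)⁻¹ := by
  classical
  obtain ⟨v⟩ : Nonempty V := Fintype.card_pos_iff.1 (by lia)
  have : Nonempty (V × V) := ⟨v, v⟩
  have hq₀ : 0 ≤ q := h.nonneg
  let e : Option {x // x ≠ v} ≃ V := Equiv.optionSubtypeNe v
  have hcard : Fintype.card {x // x ≠ v} + 1 = Fintype.card V := by
    rw [← Fintype.card_option, Fintype.card_congr e]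
  let ζ (z : Option {x // x ≠ v} × Option {x // x ≠ v}) : Ω → Prop := ξ (σ (e z.1), e z.2)
  have hζ : IsBernoulliFamily ζ q μ :=
    h.precomp (g := Prod.map (σ ∘ e) e) ((σ.injective.comp e.injective).prodMap e.injective)
  have hη : IsBernoulliFamily (fun z : Sym2 (Option {x // x ≠ v}) ↦ ζ (Quot.out z)) q μ :=
    hζ.precomp (Function.LeftInverse.injective Quot.out_eq)
  have hsub : {ω | ¬ ∃ τ : Equiv.Perm V, (∀ x, ξ (x, τ x) ω) ∧ IsTransitive (τ * σ)} ⊆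
      {ω | HasHamiltonCycle fun x y ↦ ζ (x, y) ω}ᶜ := by
    rintro ω hω ⟨π, hπ, hπζ⟩
    have hsemi : Function.Semiconj e π (σ⁻¹.trans (e.symm.trans (π.trans e)) * σ) := fun x ↦ by simp
    exact hω ⟨σ⁻¹.trans (e.symm.trans (π.trans e)), fun x ↦ by
      simpa [ζ] using hπζ (e.symm (σ⁻¹ x)), hπ.conj e hsemi⟩
  have hlog : 32 * Real.log n ≤ q * Fintype.card {x // x ≠ v} := by
    have hhalf : (Fintype.card V : ℝ) ≤ 2 * Fintype.card {x // x ≠ v} := by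
      exact_mod_cast (by lia : Fintype.card V ≤ 2 * Fintype.card {x // x ≠ v})
    nlinarith
  calc _ ≤ μ.real {ω | HasHamiltonCycle fun x y ↦ ζ (x, y) ω}ᶜ := measureReal_mono hsub
    _ ≤ μ.real {ω | HasHamiltonCycle fun x y ↦ ζ (Quot.out s(x, y)) ω}ᶜ := by
        have hmeas : MeasurableSet {ω | HasHamiltonCycle fun x y ↦ ζ (x, y) ω} :=
          hζ.measurableSet_preimage {f | HasHamiltonCycle fun x y ↦ f (x, y)}
        have hmeas' : MeasurableSet {ω | HasHamiltonCycle fun x y ↦ ζ (Quot.out s(x, y)) ω} :=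
          hζ.measurableSet_preimage {f | HasHamiltonCycle fun x y ↦ f (Quot.out s(x, y))}
        rw [probReal_compl_eq_one_sub hmeas, probReal_compl_eq_one_sub hmeas']
        exact sub_le_sub_left (hζ.measureReal_hasHamiltonCycle_sym2_le (by simp; lia)) 1
    _ ≤ 4 * ((n : ℝ) ^ 3)⁻¹ :=
        hη.measureReal_not_hasHamiltonCycle_sym2_le (by lia) (by lia) hlog

end RandomHamilton

section IsMatchingFamily

variable {Z I J : Type*} {A B : Z × Z → Prop} {F : I → Equiv.Perm Z}

/-- `F` consists of pairwise disjoint perfect matchings of the bipartite graph `A`. -/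
def IsMatchingFamily (A : Z × Z → Prop) (F : I → Equiv.Perm Z) : Prop :=
  (∀ i x, A (x, F i x)) ∧ ∀ i j x, F i x = F j x → i = j

lemma IsMatchingFamily.mono (hF : IsMatchingFamily A F) (h : ∀ e, A e → B e) :
    IsMatchingFamily B F :=
  ⟨fun i x ↦ h _ (hF.1 i x), hF.2⟩

lemma IsMatchingFamily.comp (hF : IsMatchingFamily A F) {g : J → I} (hg : Function.Injective g) :
    IsMatchingFamily A (F ∘ g) :=
  ⟨fun _ _ ↦ hF.1 _ _, fun _ _ _ h ↦ hg (hF.2 _ _ _ h)⟩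

end IsMatchingFamily

section Factor

variable {Z : Type*} [DecidableEq Z] {r : ℕ} {E F : Finset (Z × Z)}

/-- The bipartite graph with edge set `F` between two copies of `Z` is `r`-regular. -/
structure IsBiregular (F : Finset (Z × Z)) (r : ℕ) : Prop where
  card_row : ∀ x, (F.filter fun e ↦ e.1 = x).card = r
  card_col : ∀ y, (F.filter fun e ↦ e.2 = y).card = r

namespace IsBiregular

lemma exists_perm [Finite Z] (h : IsBiregular F (r + 1)) :
    ∃ π : Equiv.Perm Z, ∀ x, (x, π x) ∈ F := by
  have := Fintype.ofFinite Z
  have hall (A : Finset Z) :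
      A.card ≤ (Finset.univ.filter fun y ↦ ∃ x ∈ A, (x, y) ∈ F).card := by
    set N := Finset.univ.filter fun y ↦ ∃ x ∈ A, (x, y) ∈ F
    have hrow : (F.filter fun e ↦ e.1 ∈ A).card = A.card * (r + 1) := by
      simp [← Finset.sum_card_fiberwise_eq_card_filter, h.card_row]
    have hcol : (F.filter fun e ↦ e.2 ∈ N).card = N.card * (r + 1) := by
      simp [← Finset.sum_card_fiberwise_eq_card_filter, h.card_col]
    have hle : (F.filter fun e ↦ e.1 ∈ A).card ≤ (F.filter fun e ↦ e.2 ∈ N).card :=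
      Finset.card_le_card <| Finset.monotone_filter_right F fun e he heA ↦
        Finset.mem_filter.2 ⟨Finset.mem_univ _, e.1, heA, he⟩
    exact Nat.le_of_mul_le_mul_right (hrow ▸ hcol ▸ hle) r.succ_pos
  obtain ⟨g, hg, hgF⟩ :=
    (Fintype.all_card_le_filter_rel_iff_exists_injective fun x y ↦ (x, y) ∈ F).1 hall
  exact ⟨.ofBijective g (Finite.injective_iff_bijective.1 hg), hgF⟩

lemma filter_ne (h : IsBiregular F (r + 1)) {π : Equiv.Perm Z} (hπ : ∀ x, (x, π x) ∈ F) :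
    IsBiregular (F.filter fun e ↦ e.2 ≠ π e.1) r where
  card_row x := by
    have herase : ((F.filter fun e ↦ e.2 ≠ π e.1).filter fun e ↦ e.1 = x) =
        (F.filter fun e ↦ e.1 = x).erase (x, π x) := by
      ext e
      simp only [Finset.mem_filter, Finset.mem_erase]
      grind
    rw [herase, Finset.card_erase_of_mem (by simp [hπ]), h.card_row, Nat.add_sub_cancel]
  card_col y := by
    have herase : ((F.filter fun e ↦ e.2 ≠ π e.1).filter fun e ↦ e.2 = y) =
        (F.filter fun e ↦ e.2 = y).erase (π.symm y, y) := by
      ext e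
      simp only [Finset.mem_filter, Finset.mem_erase]
      grind
    have hmem : (π.symm y, y) ∈ F := by simpa using hπ (π.symm y)
    rw [herase, Finset.card_erase_of_mem (by simp [hmem]), h.card_col, Nat.add_sub_cancel]

theorem exists_isMatchingFamily [Finite Z] (h : IsBiregular F r) :
    ∃ f : Fin r → Equiv.Perm Z, IsMatchingFamily (· ∈ F) f := by
  induction r generalizing F with
  | zero => exact ⟨fun i ↦ i.elim0, fun i ↦ i.elim0, fun i ↦ i.elim0⟩
  | succ r ih =>
    obtain ⟨π, hπ⟩ := h.exists_perm
    obtain ⟨f, hfF, hf⟩ := ih (h.filter_ne hπ)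
    have hne (i x) : f i x ≠ π x := (Finset.mem_filter.1 (hfF i x)).2
    refine ⟨Fin.cons π f, Fin.cases hπ fun i x ↦ (Finset.mem_filter.1 (hfF i x)).1, ?_⟩
    refine Fin.cases (Fin.cases (by simp) fun j x hx ↦ ?_)
      fun i ↦ Fin.cases (fun x hx ↦ ?_) fun j x hx ↦ ?_
    · exact absurd hx.symm (hne j x)
    · exact absurd hx (hne i x)
    · exact congrArg Fin.succ (hf i j x hx)

end IsBiregular

variable [Fintype Z]

/-- A bipartite graph whose perfect matchings encode the `r`-regular subgraphs of `E`. Both sides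
consist of a copy of every pair `e` and of `r` copies of every vertex; matching `e` to itself leaves
`e` out of the subgraph, and otherwise `e` is matched on the left to a copy of its row and on the
right to a copy of its column. -/
def FactorAdj (E : Finset (Z × Z)) (r : ℕ) : (Z × Z) ⊕ (Z × Fin r) → (Z × Z) ⊕ (Z × Fin r) → Prop
  | .inl e, .inl e' => e' = e
  | .inl e, .inr c => e ∈ E ∧ c.1 = e.1
  | .inr c, .inl e => e ∈ E ∧ e.2 = c.1
  | .inr _, .inr _ => False

open Classical in
lemma card_le_card_factorAdj
    (hE : ∀ S T : Finset Z, r * (S.card + T.card) ≤ (S ×ˢ T ∩ E).card + r * Fintype.card Z)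
    (A : Finset ((Z × Z) ⊕ (Z × Fin r))) :
    A.card ≤ (Finset.univ.filter fun b ↦ ∃ a ∈ A, FactorAdj E r a b).card := by
  set N := Finset.univ.filter fun b ↦ ∃ a ∈ A, FactorAdj E r a b
  have hN {a b} (ha : a ∈ A) (hab : FactorAdj E r a b) : b ∈ N :=
    Finset.mem_filter.2 ⟨Finset.mem_univ _, a, ha, hab⟩
  let S : Finset Z := (A.toLeft ∩ E).image Prod.fst
  let T : Finset Z := A.toRight.image Prod.fst
  have hdisj : Disjoint A.toLeft (Sᶜ ×ˢ T ∩ E) := by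
    refine Finset.disjoint_left.2 fun e heA he ↦ ?_
    simp only [Finset.mem_inter, Finset.mem_product, Finset.mem_compl] at he
    exact he.1.1 (Finset.mem_image_of_mem _ (Finset.mem_inter.2 ⟨heA, he.2⟩))
  have hleft : A.toLeft ∪ (Sᶜ ×ˢ T ∩ E) ⊆ N.toLeft := by
    refine Finset.union_subset (fun e he ↦ ?_) fun e he ↦ ?_
    · exact Finset.mem_toLeft.2 (hN (Finset.mem_toLeft.1 he) rfl)
    · obtain ⟨heT, heE⟩ := Finset.mem_inter.1 he
      obtain ⟨c, hc, hce⟩ := Finset.mem_image.1 (Finset.mem_product.1 heT).2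
      exact Finset.mem_toLeft.2 (hN (Finset.mem_toRight.1 hc) ⟨heE, hce.symm⟩)
  have hright : S ×ˢ Finset.univ ⊆ N.toRight := by
    intro c hc
    obtain ⟨e, he, hec⟩ := Finset.mem_image.1 (Finset.mem_product.1 hc).1
    obtain ⟨heA, heE⟩ := Finset.mem_inter.1 he
    exact Finset.mem_toRight.2 (hN (Finset.mem_toLeft.1 heA) ⟨heE, hec.symm⟩)
  have hcopies : A.toRight ⊆ T ×ˢ Finset.univ := fun c hc ↦
    Finset.mem_product.2 ⟨Finset.mem_image_of_mem _ hc, Finset.mem_univ _⟩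
  replace hleft := Finset.card_le_card hleft
  replace hright := Finset.card_le_card hright
  replace hcopies := Finset.card_le_card hcopies
  rw [Finset.card_union_of_disjoint hdisj] at hleft
  rw [Finset.card_product, Finset.card_univ, Fintype.card_fin] at hright hcopies
  have hA := A.card_toLeft_add_card_toRight
  have hN := N.card_toLeft_add_card_toRight
  have hST := hE Sᶜ T
  rw [← S.card_compl_add_card] at hST
  linarith

omit [DecidableEq Z] [Fintype Z] in
lemma FactorAdj.eq_or_mem {e : Z × Z} {b} (h : FactorAdj E r (.inl e) b) :
    b = .inl e ∨ e ∈ E ∧ ∃ i, b = .inr (e.1, i) := by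
  rcases b with e' | ⟨x, i⟩ <;> simp_all [FactorAdj]

omit [DecidableEq Z] [Fintype Z] in
lemma FactorAdj.exists_eq_inl {y : Z} {i : Fin r} {b} (h : FactorAdj E r (.inr (y, i)) b) :
    ∃ e, e.2 = y ∧ b = .inl e := by
  rcases b with e | c <;> simp_all [FactorAdj]

lemma isBiregular_of_factorAdj {φ : (Z × Z) ⊕ (Z × Fin r) → (Z × Z) ⊕ (Z × Fin r)}
    (hφ : Function.Injective φ) (hadj : ∀ a, FactorAdj E r a (φ a)) :
    IsBiregular (Finset.univ.filter fun e ↦ φ (.inl e) ≠ .inl e) r := by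
  have hφ' : Function.Surjective φ := Finite.injective_iff_surjective.1 hφ
  have hinl (e) := (hadj (.inl e)).eq_or_mem
  have hinr (y i) := (hadj (.inr (y, i))).exists_eq_inl
  set F := Finset.univ.filter fun e ↦ φ (.inl e) ≠ .inl e
  have hF {e} : e ∈ F ↔ φ (.inl e) ≠ .inl e := by simp [F]
  refine ⟨fun x ↦ ?_, fun y ↦ ?_⟩
  · have himage : ((F.filter fun e ↦ e.1 = x).image fun e ↦ φ (.inl e)) =
        Finset.univ.image fun i ↦ .inr (x, i) := by
      ext z
      simp only [Finset.mem_image, Finset.mem_filter, hF, Finset.mem_univ, true_and]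
      constructor
      · rintro ⟨e, ⟨he, rfl⟩, rfl⟩
        obtain ⟨-, i, hi⟩ := (hinl e).resolve_left he
        exact ⟨i, hi.symm⟩
      · rintro ⟨i, rfl⟩
        obtain ⟨e | ⟨y, j⟩, he⟩ := hφ' (.inr (x, i))
        · rcases hinl e with h | ⟨-, i', h⟩ <;> exact ⟨e, by simp_all⟩
        · obtain ⟨e, -, h⟩ := hinr y j
          simp_all
    have hcard := congrArg Finset.card himage
    rwa [Finset.card_image_of_injective _ fun _ _ h ↦ Sum.inl_injective (hφ h),
      Finset.card_image_of_injective _ fun _ _ h ↦ by simpa using h,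
      Finset.card_univ, Fintype.card_fin] at hcard
  · have himage : (F.filter fun e ↦ e.2 = y).image Sum.inl =
        Finset.univ.image fun j ↦ φ (.inr (y, j)) := by
      ext z
      simp only [Finset.mem_image, Finset.mem_filter, hF, Finset.mem_univ, true_and]
      constructor
      · rintro ⟨e, ⟨he, rfl⟩, rfl⟩
        obtain ⟨e' | ⟨y, j⟩, h⟩ := hφ' (.inl e)
        · rcases hinl e' with h' | ⟨-, i', h'⟩ <;> simp_all
        · obtain ⟨e', rfl, h'⟩ := hinr y j
          exact ⟨j, by simp_all⟩
      · rintro ⟨j, rfl⟩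
        obtain ⟨e, rfl, h⟩ := hinr y j
        exact ⟨e, ⟨fun he ↦ by simpa using hφ (he.trans h.symm), rfl⟩, h.symm⟩
    have hcard := congrArg Finset.card himage
    rwa [Finset.card_image_of_injective _ Sum.inl_injective,
      Finset.card_image_of_injective _ fun _ _ h ↦ by simpa using hφ h,
      Finset.card_univ, Fintype.card_fin] at hcard

lemma exists_isBiregular
    (hE : ∀ S T : Finset Z, r * (S.card + T.card) ≤ (S ×ˢ T ∩ E).card + r * Fintype.card Z) :
    ∃ F ⊆ E, IsBiregular F r := by
  classical
  obtain ⟨φ, hφ, hadj⟩ := (Fintype.all_card_le_filter_rel_iff_exists_injective (FactorAdj E r)).1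
    (by convert card_le_card_factorAdj hE)
  refine ⟨_, fun e he ↦ ?_, isBiregular_of_factorAdj hφ hadj⟩
  exact ((hadj (.inl e)).eq_or_mem.resolve_left (Finset.mem_filter.1 he).2).1

theorem exists_isMatchingFamily
    (hE : ∀ S T : Finset Z, r * (S.card + T.card) ≤ (S ×ˢ T ∩ E).card + r * Fintype.card Z) :
    ∃ f : Fin r → Equiv.Perm Z, IsMatchingFamily (· ∈ E) f := by
  obtain ⟨F, hFE, hF⟩ := exists_isBiregular hE
  obtain ⟨f, hf⟩ := hF.exists_isMatchingFamily
  exact ⟨f, hf.mono fun _ ↦ @hFE _⟩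

end Factor

section RandomBipartite

variable {Z Ω : Type*} [Fintype Z] [DecidableEq Z] [MeasurableSpace Ω] {μ : Measure Ω}
  [IsProbabilityMeasure μ] {ξ : Z × Z → Ω → Prop} {p ε : ℝ} {Ex : Finset (Z × Z)} {d n : ℕ}

omit [Fintype Z] in
lemma card_mul_card_le_card_sdiff_add (hEx : ∀ x, (Ex.filter fun e ↦ e.1 = x).card ≤ d)
    (S T : Finset Z) : S.card * T.card ≤ (S ×ˢ T \ Ex).card + d * S.card := by
  have hinter : (S ×ˢ T ∩ Ex).card ≤ d * S.card :=
    Finset.card_le_mul_card_image_of_maps_to (f := Prod.fst)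
      (fun e he ↦ (Finset.mem_product.1 (Finset.mem_inter.1 he).1).1) d fun x _ ↦
        (Finset.card_le_card (Finset.filter_subset_filter _ Finset.inter_subset_right)).trans
          (hEx x)
  calc S.card * T.card = (S ×ˢ T \ Ex).card + (S ×ˢ T ∩ Ex).card := by
        rw [Finset.card_sdiff_add_card_inter, Finset.card_product]
    _ ≤ (S ×ˢ T \ Ex).card + d * S.card := by gcongr

open Classical in
lemma measureReal_few_edges_le (h : IsBernoulliFamily ξ p μ) (hε0 : 0 ≤ ε) (hε1 : ε ≤ 1)
    (hEx : ∀ x, (Ex.filter fun e ↦ e.1 = x).card ≤ d) (hd : 4 * d ≤ ε * Fintype.card Z)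
    {S T : Finset Z} (hST : S.card ≤ T.card) (hZ : Fintype.card Z < S.card + T.card) :
    μ.real {ω | (((S ×ˢ T \ Ex).filter (ξ · ω)).card : ℝ) ≤ (1 - ε) * (p * (S.card * T.card))} ≤
      Real.exp (-(S.card * (ε ^ 2 * (p * Fintype.card Z) / 32))) := by
  obtain ⟨x, -⟩ := Finset.card_pos.1 (by lia : 0 < T.card)
  have : Nonempty (Z × Z) := ⟨(x, x)⟩
  have hp : 0 ≤ p := h.nonneg
  set W := S ×ˢ T \ Ex
  have hT : (Fintype.card Z : ℝ) ≤ 2 * T.card := by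
    exact_mod_cast (by lia : Fintype.card Z ≤ 2 * T.card)
  have hW : (1 - ε / 2) * (S.card * T.card) ≤ W.card := by
    have hWd : (S.card * T.card : ℝ) ≤ W.card + d * S.card := by
      exact_mod_cast card_mul_card_le_card_sdiff_add hEx S T
    have hdT : (d : ℝ) ≤ ε / 2 * T.card := by nlinarith
    nlinarith [mul_le_mul_of_nonneg_right hdT S.card.cast_nonneg]
  have hWZ : (S.card : ℝ) * Fintype.card Z ≤ 4 * W.card := by
    nlinarith [mul_le_mul_of_nonneg_left hT (S.card.cast_nonneg (α := ℝ))]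
  calc μ.real {ω | ((W.filter (ξ · ω)).card : ℝ) ≤ (1 - ε) * (p * (S.card * T.card))}
      ≤ μ.real {ω | ((W.filter (ξ · ω)).card : ℝ) ≤ (1 - ε / 2) * (p * W.card)} := by
        refine measureReal_mono (fun ω hω ↦ ?_) (measure_ne_top _ _)
        refine le_trans (Set.mem_ofPred_eq ▸ hω) ?_
        calc (1 - ε) * (p * (S.card * T.card))
            ≤ (1 - ε / 2) ^ 2 * (p * (S.card * T.card)) := by
              gcongr
              nlinarith [sq_nonneg ε]
          _ = (1 - ε / 2) * (p * ((1 - ε / 2) * (S.card * T.card))) := by ring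
          _ ≤ (1 - ε / 2) * (p * W.card) := by
              gcongr
              linarith
    _ ≤ Real.exp (-((ε / 2) ^ 2 / 2 * (p * W.card))) :=
        h.measureReal_card_filter_le W (by linarith)
    _ ≤ Real.exp (-(S.card * (ε ^ 2 * (p * Fintype.card Z) / 32))) := by
        refine Real.exp_le_exp.2 (neg_le_neg ?_)
        nlinarith [mul_le_mul_of_nonneg_left hWZ (mul_nonneg (sq_nonneg ε) hp)]

omit [DecidableEq Z] [IsProbabilityMeasure μ] in
lemma measureReal_exists_card_lt_le [IsFiniteMeasure μ] (hn : 0 < n) (hZn : Fintype.card Z ≤ n)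
    {A : Finset Z × Finset Z → Set Ω}
    (hA : ∀ P : Finset Z × Finset Z, μ.real (A P) ≤ ((n : ℝ) ^ (7 * P.1.card))⁻¹) :
    μ.real {ω | ∃ P : Finset Z × Finset Z, P.2.card < P.1.card ∧ ω ∈ A P} ≤ ((n : ℝ) ^ 3)⁻¹ := by
  set M := Fintype.card Z
  let pairs (k : (_ : ℕ) × ℕ) : Finset (Finset Z × Finset Z) :=
    Finset.univ.powersetCard k.1 ×ˢ Finset.univ.powersetCard k.2
  let sizes : Finset ((_ : ℕ) × ℕ) := (Finset.Icc 1 M).sigma fun s ↦ Finset.range s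
  have hsizes : sizes.card ≤ n ^ 2 := by
    rw [Finset.card_sigma, sq]
    calc ∑ s ∈ Finset.Icc 1 M, (Finset.range s).card ≤ (Finset.Icc 1 M).card • n :=
          Finset.sum_le_card_nsmul _ _ _ fun s hs ↦ by
            rw [Finset.card_range]
            exact (Finset.mem_Icc.1 hs).2.trans hZn
      _ ≤ n * n := by
          rw [Nat.card_Icc, Nat.add_sub_cancel, smul_eq_mul]
          gcongr
  have hpairs (k) (hk : k ∈ sizes) : μ.real (⋃ P ∈ pairs k, A P) ≤ ((n : ℝ) ^ 5)⁻¹ := by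
    simp only [sizes, Finset.mem_sigma, Finset.mem_Icc, Finset.mem_range] at hk
    refine measureReal_biUnion_powersetCard_le (j := 7 * k.1) hn hZn (by lia) fun P hP ↦ ?_
    rw [← (Finset.mem_powersetCard.1 (Finset.mem_product.1 hP).1).2]
    exact hA P
  have hsub : {ω | ∃ P : Finset Z × Finset Z, P.2.card < P.1.card ∧ ω ∈ A P} ⊆
      ⋃ k ∈ sizes, ⋃ P ∈ pairs k, A P := by
    rintro ω ⟨P, hP, hω⟩
    have hcard := P.1.card_le_univ
    simp only [Set.mem_iUnion]
    refine ⟨⟨P.1.card, P.2.card⟩, ?_, P, by simp [pairs], hω⟩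
    simp only [sizes, Finset.mem_sigma, Finset.mem_Icc, Finset.mem_range]
    lia
  calc _ ≤ ∑ k ∈ sizes, μ.real (⋃ P ∈ pairs k, A P) :=
        (measureReal_mono hsub (measure_ne_top _ _)).trans (measureReal_biUnion_finset_le _ _)
    _ ≤ sizes.card * ((n : ℝ) ^ 5)⁻¹ := by
        simpa using Finset.sum_le_card_nsmul _ _ _ hpairs
    _ ≤ (n : ℝ) ^ 2 * ((n : ℝ) ^ 5)⁻¹ := by
        gcongr
        exact_mod_cast hsizes
    _ = ((n : ℝ) ^ 3)⁻¹ := by field_simp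

open Classical in
lemma measureReal_exists_few_edges_le_of_card_le (h : IsBernoulliFamily ξ p μ) (hε0 : 0 ≤ ε)
    (hε1 : ε ≤ 1) (hEx : ∀ x, (Ex.filter fun e ↦ e.1 = x).card ≤ d)
    (hd : 4 * d ≤ ε * Fintype.card Z) (hn : 0 < n) (hZn : Fintype.card Z ≤ n)
    (hpn : 224 * Real.log n ≤ ε ^ 2 * (p * Fintype.card Z)) :
    μ.real {ω | ∃ S T : Finset Z, S.card ≤ T.card ∧ Fintype.card Z < S.card + T.card ∧
      (((S ×ˢ T \ Ex).filter (ξ · ω)).card : ℝ) ≤ (1 - ε) * (p * (S.card * T.card))} ≤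
      ((n : ℝ) ^ 3)⁻¹ := by
  set M := Fintype.card Z
  -- The union bound runs over the pairs `(S, Tᶜ)`, in which `Tᶜ` is smaller than `S`.
  let few (P : Finset Z × Finset Z) : Set Ω := {ω | P.1.card ≤ P.2ᶜ.card ∧
    M < P.1.card + P.2ᶜ.card ∧
    (((P.1 ×ˢ P.2ᶜ \ Ex).filter (ξ · ω)).card : ℝ) ≤ (1 - ε) * (p * (P.1.card * P.2ᶜ.card))}
  have hfew (P) : μ.real (few P) ≤ ((n : ℝ) ^ (7 * P.1.card))⁻¹ := by
    by_cases hc : P.1.card ≤ P.2ᶜ.card ∧ M < P.1.card + P.2ᶜ.card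
    · calc μ.real (few P) ≤ _ := measureReal_mono (fun ω hω ↦ hω.2.2) (measure_ne_top _ _)
        _ ≤ Real.exp (-(P.1.card * (ε ^ 2 * (p * M) / 32))) :=
          measureReal_few_edges_le h hε0 hε1 hEx hd hc.1 hc.2
        _ ≤ ((n : ℝ) ^ (7 * P.1.card))⁻¹ := by
          refine exp_neg_le_inv_pow hn ?_
          push_cast
          linarith [mul_le_mul_of_nonneg_left hpn (P.1.card.cast_nonneg (α := ℝ))]
    · have hempty : few P = ∅ := Set.eq_empty_of_forall_notMem fun ω hω ↦ hc ⟨hω.1, hω.2.1⟩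
      rw [hempty, measureReal_empty]
      positivity
  refine (measureReal_mono ?_ (measure_ne_top _ _)).trans
    (measureReal_exists_card_lt_le hn hZn hfew)
  rintro ω ⟨S, T, hST, hZ, hω⟩
  have hcompl := T.card_compl_add_card
  refine ⟨(S, Tᶜ), by lia, ?_⟩
  simpa only [few, Set.mem_ofPred_eq, compl_compl] using ⟨hST, hZ, hω⟩

open Classical in
lemma measureReal_exists_few_edges_le (h : IsBernoulliFamily ξ p μ) (hε0 : 0 ≤ ε) (hε1 : ε ≤ 1)
    (hEx : ∀ x, (Ex.filter fun e ↦ e.1 = x).card ≤ d)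
    (hEx' : ∀ y, (Ex.filter fun e ↦ e.2 = y).card ≤ d)
    (hd : 4 * d ≤ ε * Fintype.card Z) (hn : 0 < n) (hZn : Fintype.card Z ≤ n)
    (hpn : 224 * Real.log n ≤ ε ^ 2 * (p * Fintype.card Z)) :
    μ.real {ω | ∃ S T : Finset Z, Fintype.card Z < S.card + T.card ∧
      (((S ×ˢ T \ Ex).filter (ξ · ω)).card : ℝ) ≤ (1 - ε) * (p * (S.card * T.card))} ≤
      2 * ((n : ℝ) ^ 3)⁻¹ := by
  have hswap (x) : ((Ex.image Prod.swap).filter fun e ↦ e.1 = x).card ≤ d := by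
    rw [Finset.filter_image, Finset.card_image_of_injective _ Prod.swap_injective]
    exact hEx' x
  have hle := measureReal_exists_few_edges_le_of_card_le h hε0 hε1 hEx hd hn hZn hpn
  have hge := measureReal_exists_few_edges_le_of_card_le (h.precomp Prod.swap_injective) hε0 hε1
    hswap hd hn hZn hpn
  refine ((measureReal_mono ?_ (measure_ne_top _ _)).trans
    (measureReal_union_le _ _)).trans ((add_le_add hle hge).trans_eq (two_mul _).symm)
  rintro ω ⟨S, T, hZ, hω⟩
  rcases le_total S.card T.card with hST | hTS
  · exact .inl ⟨S, T, hST, hZ, hω⟩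
  · refine .inr ⟨T, S, hTS, by lia, ?_⟩
    have himage : (T ×ˢ S \ Ex.image Prod.swap).filter (fun e ↦ ξ e.swap ω) =
        ((S ×ˢ T \ Ex).filter (ξ · ω)).image Prod.swap := by
      ext ⟨a, b⟩
      simp only [Finset.mem_filter, Finset.mem_sdiff, Finset.mem_product, Finset.mem_image,
        Prod.exists, Prod.swap_prod_mk, Prod.mk.injEq]
      grind
    rwa [himage, Finset.card_image_of_injective _ Prod.swap_injective,
      mul_comm (T.card : ℝ)]

theorem measureReal_not_exists_isMatchingFamily_le (h : IsBernoulliFamily ξ p μ) (hε0 : 0 ≤ ε)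
    (hε1 : ε ≤ 1) (hEx : ∀ x, (Ex.filter fun e ↦ e.1 = x).card ≤ d)
    (hEx' : ∀ y, (Ex.filter fun e ↦ e.2 = y).card ≤ d)
    (hd : 4 * d ≤ ε * Fintype.card Z) (hn : 0 < n) (hZn : Fintype.card Z ≤ n)
    (hpn : 224 * Real.log n ≤ ε ^ 2 * (p * Fintype.card Z)) {I : Type*} [Fintype I]
    (hI : Fintype.card I ≤ (1 - ε) * (p * Fintype.card Z)) :
    μ.real {ω | ¬ ∃ F : I → Equiv.Perm Z, IsMatchingFamily (fun e ↦ e ∉ Ex ∧ ξ e ω) F} ≤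
      2 * ((n : ℝ) ^ 3)⁻¹ := by
  classical
  refine (measureReal_mono (fun ω hω ↦ ?_) (measure_ne_top _ _)).trans
    (measureReal_exists_few_edges_le h hε0 hε1 hEx hEx' hd hn hZn hpn)
  by_contra hmany
  refine hω ?_
  simp only [Set.mem_ofPred_eq, not_exists, not_and, not_le] at hmany
  set M := Fintype.card Z
  set r := Fintype.card I
  let E : Finset (Z × Z) := Finset.univ.filter fun e ↦ e ∉ Ex ∧ ξ e ω
  have hE (S T : Finset Z) : r * (S.card + T.card) ≤ (S ×ˢ T ∩ E).card + r * M := by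
    rcases le_or_gt (S.card + T.card) M with hST | hST
    · exact (Nat.mul_le_mul_left r hST).trans (Nat.le_add_left _ _)
    have hedges : (S ×ˢ T \ Ex).filter (ξ · ω) = S ×ˢ T ∩ E := by
      ext e
      simp [E, and_assoc]
    replace hmany := hmany S T hST
    rw [hedges] at hmany
    have : Nonempty (Z × Z) :=
      (Fintype.card_pos_iff.1 (by have := S.card_le_univ; have := T.card_le_univ; lia)).elim
        fun x ↦ ⟨(x, x)⟩
    have hp : 0 ≤ p := h.nonneg
    have hS : (S.card : ℝ) ≤ M := by exact_mod_cast S.card_le_univ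
    have hT : (T.card : ℝ) ≤ M := by exact_mod_cast T.card_le_univ
    have hSTM : (M : ℝ) < S.card + T.card := by exact_mod_cast hST
    have hcount : (r : ℝ) * (S.card + T.card - M) ≤ (1 - ε) * (p * (S.card * T.card)) := by
      calc (r : ℝ) * (S.card + T.card - M) ≤ (1 - ε) * (p * M) * (S.card + T.card - M) :=
            mul_le_mul_of_nonneg_right hI (by linarith)
        _ = (1 - ε) * p * (S.card * T.card - (M - S.card) * (M - T.card)) := by ring
        _ ≤ (1 - ε) * p * (S.card * T.card) := by
            refine mul_le_mul_of_nonneg_left (sub_le_self _ ?_) (mul_nonneg (by linarith) hp)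
            exact mul_nonneg (by linarith) (by linarith)
        _ = (1 - ε) * (p * (S.card * T.card)) := by ring
    have hreal : (r : ℝ) * (S.card + T.card) ≤ (S ×ˢ T ∩ E).card + r * M := by linarith
    exact_mod_cast hreal
  obtain ⟨f, hf⟩ := exists_isMatchingFamily hE
  exact ⟨_, (hf.comp (Fintype.equivFin I).injective).mono fun e he ↦ (Finset.mem_filter.1 he).2⟩

end RandomBipartite

section TransitivePacking

variable {V : Type*} {s : V → V}

lemma IsTransitive.surjective (hs : IsTransitive s) : Function.Surjective s := fun v ↦ by
  obtain ⟨t, ht⟩ := hs (s v) v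
  exact ⟨s^[t] v, by rw [← Function.iterate_succ_apply' s t v, Function.iterate_succ_apply, ht]⟩

lemma IsTransitive.apply_ne [Nontrivial V] (hs : IsTransitive s) (v : V) : s v ≠ v := fun hv ↦ by
  obtain ⟨u, hu⟩ := exists_ne v
  obtain ⟨t, ht⟩ := hs v u
  exact hu (by rw [← ht, Function.iterate_fixed hv])

lemma IsTransitive.exists_zmod_equiv [Finite V] [Nonempty V] (hs : IsTransitive s) :
    ∃ w : ZMod (Nat.card V) ≃ V, ∀ i, w (i + 1) = s (w i) := by
  classical
  have := Fintype.ofFinite V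
  have : NeZero (Nat.card V) := ⟨Nat.card_pos.ne'⟩
  let π : Equiv.Perm V := .ofBijective s hs.surjective.bijective_of_finite
  have hcard : (Finset.univ : Finset V).card = Nat.card V := by simp
  have hπ : π.IsCycleOn ((Finset.univ : Finset V) : Set V) := by
    refine ⟨by simp, fun u _ v _ ↦ ?_⟩
    obtain ⟨t, ht⟩ := hs u v
    exact ⟨t, by rw [zpow_natCast, ← Equiv.Perm.iterate_eq_pow]; exact ht⟩
  obtain ⟨v₀⟩ := ‹Nonempty V›
  let w (i : ZMod (Nat.card V)) : V := (π ^ i.val) v₀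
  have hw : Function.Surjective w := fun v ↦ by
    obtain ⟨t, ht, rfl⟩ := hπ.exists_pow_eq (Finset.mem_univ v₀) (Finset.mem_univ v)
    exact ⟨t, by simp only [w, ZMod.val_natCast_of_lt (hcard ▸ ht)]⟩
  refine ⟨.ofBijective w ((Fintype.bijective_iff_surjective_and_card w).2 ⟨hw, by simp⟩),
    fun i ↦ ?_⟩
  calc w (i + 1) = (π ^ (i.val + 1)) v₀ :=
        (hπ.pow_apply_eq_pow_apply (Finset.mem_univ v₀)).2 (by
          rw [hcard, ← ZMod.natCast_eq_natCast_iff]; simp)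
    _ = s (w i) := by rw [pow_succ']; rfl

lemma IsTransitive.isHamiltonCycle [Finite V] [Nonempty V] (hs : IsTransitive s) {D : Digraph V}
    (hD : ∀ v, D.Adj v (s v)) : D.IsHamiltonCycle (Set.range fun v ↦ (v, s v)) := by
  obtain ⟨w, hw⟩ := hs.exists_zmod_equiv
  refine ⟨w, ?_, by rintro _ ⟨v, rfl⟩; exact hD v⟩
  simp only [hw]
  exact (w.surjective.range_comp fun v ↦ (v, s v)).symm

lemma exists_isHamiltonPacking_of_isTransitive {β : Type*} [Fintype β] [Finite V] [Nonempty V]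
    {D : Digraph V} {s : β → V → V} (hs : ∀ b, IsTransitive (s b))
    (hadj : ∀ b v, D.Adj v (s b v)) (hdisj : ∀ b b' v, s b v = s b' v → b = b') :
    ∃ F, D.IsHamiltonPacking F ∧ F.card = Fintype.card β := by
  classical
  let C (b : β) : Set (V × V) := Set.range fun v ↦ (v, s b v)
  have hC {b b'} {e : V × V} (he : e ∈ C b) (he' : e ∈ C b') : b = b' := by
    obtain ⟨v, rfl⟩ := he
    obtain ⟨v', hv⟩ := he'
    obtain ⟨rfl, hv⟩ := Prod.mk.inj hv
    exact hdisj _ _ _ hv.symm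
  have hinj : Function.Injective C := fun b b' hbb' ↦ by
    obtain ⟨e, he⟩ : (C b).Nonempty := Set.range_nonempty _
    exact hC he (hbb' ▸ he)
  refine ⟨Finset.univ.image C, ⟨?_, ?_⟩, by rw [Finset.card_image_of_injective _ hinj,
    Finset.card_univ]⟩ <;> simp only [Finset.mem_image, Finset.mem_univ, true_and]
  · rintro _ ⟨b, rfl⟩
    exact (hs b).isHamiltonCycle (hadj b)
  · rintro _ ⟨b, rfl⟩ _ ⟨b', rfl⟩ hne
    exact Set.disjoint_left.2 fun e he he' ↦ hne (by rw [hC he he'])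

end TransitivePacking

section Walk

variable {L m r : ℕ}

/-- The vertices, split into `L` clusters of size `m` indexed by the residues modulo `L`, and `r`
leftover vertices. -/
abbrev Clustered (L m r : ℕ) : Type := (ZMod L × Fin m) ⊕ Fin r

/-- The cluster `c` extended by the leftover vertices. -/
def clusterEmb (c : ZMod L) : Fin m ⊕ Fin r → Clustered L m r :=
  Sum.map (Prod.mk c) id

lemma clusterEmb_injective (c : ZMod L) :
    Function.Injective (clusterEmb c : Fin m ⊕ Fin r → Clustered L m r) :=
  (Prod.mk_right_injective c).sumMap Function.injective_id

/-- The first element of `Fin m` that `h` visits after `x`, provided that `h` never maps a leftover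
vertex to a leftover vertex. -/
def bypass (h : Equiv.Perm (Fin m ⊕ Fin r)) (x : Fin m) : Fin m :=
  Sum.elim id (fun j ↦ Sum.elim id (fun _ ↦ x) (h (.inr j))) (h (.inl x))

variable {h : Equiv.Perm (Fin m ⊕ Fin r)}

lemma bypass_eq_iff (hh : ∀ j, (h (.inr j)).isLeft) {x y : Fin m} : bypass h x = y ↔
    h (.inl x) = .inl y ∨ ∃ j, h (.inl x) = .inr j ∧ h (.inr j) = .inl y := by
  rcases hx : h (.inl x) with z | j
  · simp [bypass, hx]
  · obtain ⟨z, hz⟩ := Sum.isLeft_iff.1 (hh j)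
    simp [bypass, hx, hz]

lemma bypass_injective (hh : ∀ j, (h (.inr j)).isLeft) : Function.Injective (bypass h) := by
  intro x x' hxx'
  rcases (bypass_eq_iff hh).1 hxx' with hx | ⟨j, hxj, hj⟩ <;>
    rcases (bypass_eq_iff hh).1 (rfl : bypass h x' = _) with hx' | ⟨j', hxj', hj'⟩
  · exact Sum.inl_injective (h.injective (hx.trans hx'.symm))
  · exact absurd (h.injective (hx.trans hj'.symm)) (by simp)
  · exact absurd (h.injective (hj.trans hx'.symm)) (by simp)
  · obtain rfl : j = j' := Sum.inr_injective (h.injective (hj.trans hj'.symm))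
    exact Sum.inl_injective (h.injective (hxj.trans hxj'.symm))

open Classical in
/-- `bypass h` as a permutation, with the junk value `1` where `bypass h` is not injective. -/
noncomputable def bypassPerm (h : Equiv.Perm (Fin m ⊕ Fin r)) : Equiv.Perm (Fin m) :=
  if hh : Function.Injective (bypass h) then .ofBijective _ hh.bijective_of_finite else 1

lemma bypassPerm_apply (hh : ∀ j, (h (.inr j)).isLeft) (x : Fin m) :
    bypassPerm h x = bypass h x := by
  simp [bypassPerm, bypass_injective hh]

/-- The composition `g (k + j - 1) * ⋯ * g (k + 1) * g k`. -/
def slotComp (g : ZMod L → Equiv.Perm (Fin m)) (k : ZMod L) : ℕ → Equiv.Perm (Fin m)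
  | 0 => 1
  | j + 1 => g (k + j) * slotComp g k j

lemma slotComp_congr {g g' : ZMod L → Equiv.Perm (Fin m)} {k : ZMod L} {j : ℕ}
    (h : ∀ i < j, g (k + i) = g' (k + i)) : slotComp g k j = slotComp g' k j := by
  induction j with
  | zero => rfl
  | succ j ih => rw [slotComp, slotComp, ih fun i hi ↦ h i (by lia), h j (by lia)]

lemma slotComp_add_one_self [NeZero L] (g : ZMod L → Equiv.Perm (Fin m)) (k : ZMod L) :
    slotComp g (k + 1) L = g k * slotComp g (k + 1) (L - 1) := by
  obtain ⟨l, rfl⟩ := Nat.exists_eq_add_one_of_ne_zero (NeZero.ne L)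
  have hl : (l : ZMod (l + 1)) + 1 = 0 := by exact_mod_cast ZMod.natCast_self (l + 1)
  have hk : k + 1 + (l : ZMod (l + 1)) = k := by linear_combination hl
  rw [slotComp, hk, Nat.add_sub_cancel]

lemma add_one_add_natCast_ne (k : ZMod L) {i : ℕ} (hi : i < L - 1) : k + 1 + i ≠ k := fun h ↦ by
  have hdvd : ((i + 1 : ℕ) : ZMod L) = 0 := by push_cast; linear_combination h
  exact absurd (Nat.le_of_dvd i.succ_pos ((ZMod.natCast_eq_zero_iff _ _).1 hdvd)) (by lia)

/-- The walk through the clusters in their cyclic order: from cluster `k` to cluster `k + 1` it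
follows `f k`, except that from cluster `1` to cluster `2` it follows `h`, possibly through a
leftover vertex. -/
def walk (f : ZMod L → Equiv.Perm (Fin m)) (h : Equiv.Perm (Fin m ⊕ Fin r)) :
    Clustered L m r → Clustered L m r
  | .inl (k, x) => if k = 1 then clusterEmb 2 (h (.inl x)) else .inl (k + 1, f k x)
  | .inr j => clusterEmb 2 (h (.inr j))

/-- The bijection that `walk f h` induces from cluster `k` to cluster `k + 1`. -/
noncomputable def slotMap (f : ZMod L → Equiv.Perm (Fin m)) (h : Equiv.Perm (Fin m ⊕ Fin r))
    (k : ZMod L) : Equiv.Perm (Fin m) :=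
  if k = 1 then bypassPerm h else f k

/-- `walk f h` leads from `u` to `v`. -/
abbrev WalkReaches (f : ZMod L → Equiv.Perm (Fin m)) (h : Equiv.Perm (Fin m ⊕ Fin r)) :
    Clustered L m r → Clustered L m r → Prop :=
  Relation.ReflTransGen fun u v ↦ walk f h u = v

variable {f : ZMod L → Equiv.Perm (Fin m)}

lemma isTransitive_walk_of_walkReaches (hR : ∀ u v, WalkReaches f h u v) :
    IsTransitive (walk f h) := fun u v ↦ by
  induction hR u v with
  | refl => exact ⟨0, rfl⟩
  | tail _ hstep ih =>
    obtain ⟨t, rfl⟩ := ih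
    exact ⟨t + 1, by rw [Function.iterate_succ_apply', hstep]⟩

variable (hh : ∀ j, (h (.inr j)).isLeft)
include hh

lemma walkReaches_slotMap (k : ZMod L) (x : Fin m) :
    WalkReaches f h (.inl (k, x)) (.inl (k + 1, slotMap f h k x)) := by
  by_cases hk : k = 1
  · subst hk
    rw [slotMap, if_pos rfl, bypassPerm_apply hh, one_add_one_eq_two]
    rcases (bypass_eq_iff hh).1 (rfl : bypass h x = _) with hx | ⟨j, hxj, hj⟩
    · exact .single (by simp [walk, hx, clusterEmb])
    · exact .head (b := .inr j) (by simp [walk, hxj, clusterEmb])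
        (.single (by simp [walk, hj, clusterEmb]))
  · exact .single (by simp [walk, slotMap, hk])

lemma walkReaches_slotComp (k : ZMod L) (j : ℕ) (x : Fin m) :
    WalkReaches f h (.inl (k, x)) (.inl (k + j, slotComp (slotMap f h) k j x)) := by
  induction j with
  | zero => simp only [Nat.cast_zero, add_zero]; exact .refl
  | succ j ih =>
    rw [Nat.cast_add_one, ← add_assoc]
    exact ih.trans (walkReaches_slotMap hh _ _)

lemma walkReaches_inl_inl [NeZero L] {k : ZMod L}
    (hk : IsTransitive (slotComp (slotMap f h) k L)) (u v : ZMod L × Fin m) :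
    WalkReaches f h (.inl u) (.inl v) := by
  obtain ⟨c, x⟩ := u
  obtain ⟨d, y⟩ := v
  have hround (z : Fin m) (t : ℕ) :
      WalkReaches f h (.inl (k, z)) (.inl (k, (slotComp (slotMap f h) k L)^[t] z)) := by
    induction t with
    | zero => exact .refl
    | succ t ih =>
      rw [Function.iterate_succ_apply']
      simpa using ih.trans (walkReaches_slotComp hh k L _)
  have hto := walkReaches_slotComp (f := f) hh c (k - c).val x
  have hfrom := walkReaches_slotComp (f := f) hh k (d - k).val
    ((slotComp (slotMap f h) k (d - k).val).symm y)
  rw [ZMod.natCast_zmod_val, add_sub_cancel] at hto hfrom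
  rw [Equiv.apply_symm_apply] at hfrom
  obtain ⟨t, ht⟩ := hk (slotComp (slotMap f h) c (k - c).val x)
    ((slotComp (slotMap f h) k (d - k).val).symm y)
  exact hto.trans ((ht ▸ hround _ t).trans hfrom)

theorem isTransitive_walk [NeZero L] {k : ZMod L}
    (hk : IsTransitive (slotComp (slotMap f h) k L)) : IsTransitive (walk f h) := by
  have hleave (u : Clustered L m r) : ∃ v, WalkReaches f h u (.inl v) := by
    rcases u with u | j
    · exact ⟨u, .refl⟩
    · obtain ⟨y, hy⟩ := Sum.isLeft_iff.1 (hh j)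
      exact ⟨(2, y), .single (by simp [walk, hy, clusterEmb])⟩
  have henter (v : Clustered L m r) : ∃ u, WalkReaches f h (.inl u) v := by
    rcases v with v | j
    · exact ⟨v, .refl⟩
    · obtain ⟨x, hx⟩ : ∃ x, h (.inl x) = .inr j := by
        rcases hj : h.symm (.inr j) with x | j' <;> rw [Equiv.symm_apply_eq] at hj
        · exact ⟨x, hj.symm⟩
        · simpa [← hj] using hh j'
      exact ⟨(1, x), .single (by simp [walk, hx, clusterEmb])⟩
  refine isTransitive_walk_of_walkReaches fun u v ↦ ?_
  obtain ⟨u', hu⟩ := hleave u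
  obtain ⟨v', hv⟩ := henter v
  exact hu.trans ((walkReaches_inl_inl hh hk u' v').trans hv)

end Walk

section Packing

variable {L m r : ℕ} {f : ZMod L → Equiv.Perm (Fin m)} {h : Equiv.Perm (Fin m ⊕ Fin r)}

/-- The arcs from the cluster `a * k` to the cluster `a * k + a`. -/
def slotArc (a k : ZMod L) (z : Fin m × Fin m) : Clustered L m r × Clustered L m r :=
  (.inl (a * k, z.1), .inl (a * k + a, z.2))

/-- The arcs from the cluster `a` to the cluster `a + a`, with the leftover vertices added on both
sides. -/
def extArc (a : ZMod L) (z : (Fin m ⊕ Fin r) × (Fin m ⊕ Fin r)) :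
    Clustered L m r × Clustered L m r :=
  (clusterEmb a z.1, clusterEmb (a + a) z.2)

/-- Multiplication of the indices of the clusters by `a`. -/
def scale (a : (ZMod L)ˣ) : Clustered L m r ≃ Clustered L m r :=
  ((Units.mulLeft a).prodCongr (.refl _)).sumCongr (.refl _)

lemma scale_clusterEmb (a : (ZMod L)ˣ) (c : ZMod L) (z : Fin m ⊕ Fin r) :
    scale a (clusterEmb c z) = clusterEmb (a.1 * c) z := by
  cases z <;> rfl

lemma eq_inl_or_eq_clusterEmb_one (u : Clustered L m r) :
    (∃ k x, k ≠ 1 ∧ u = .inl (k, x)) ∨ ∃ z, u = clusterEmb 1 z := by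
  rcases u with ⟨k, x⟩ | j
  · by_cases hk : k = 1
    · exact .inr ⟨.inl x, by rw [hk]; rfl⟩
    · exact .inl ⟨k, x, hk, rfl⟩
  · exact .inr ⟨.inr j, rfl⟩

lemma walk_inl {k : ZMod L} (hk : k ≠ 1) (x : Fin m) :
    walk f h (.inl (k, x)) = .inl (k + 1, f k x) := by
  simp [walk, hk]

lemma walk_clusterEmb_one (z : Fin m ⊕ Fin r) : walk f h (clusterEmb 1 z) = clusterEmb 2 (h z) := by
  cases z <;> simp [walk, clusterEmb]

lemma scale_walk_inl (a : (ZMod L)ˣ) {k : ZMod L} (hk : k ≠ 1) (x : Fin m) :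
    (scale a (.inl (k, x)), scale a (walk f h (.inl (k, x)))) = slotArc a.1 k (x, f k x) := by
  simp [walk_inl hk, scale, slotArc, mul_add]

lemma scale_walk_clusterEmb_one (a : (ZMod L)ˣ) (z : Fin m ⊕ Fin r) :
    (scale a (clusterEmb 1 z), scale a (walk f h (clusterEmb 1 z))) = extArc a.1 (z, h z) := by
  simp [walk_clusterEmb_one, scale_clusterEmb, extArc, mul_two]

/-- The step of the only walk that may use a given arc; the arcs `extArc a z` out of leftover
vertices end in the cluster `a + a`, whence the division by `2`. -/
def arcStep : Clustered L m r × Clustered L m r → ZMod L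
  | (.inl (c, _), .inl (c', _)) => c' - c
  | (.inl (c, _), .inr _) => c
  | (.inr _, .inl (c', _)) => c' * 2⁻¹
  | (.inr _, .inr _) => 0

lemma arcStep_slotArc (a k : ZMod L) (z : Fin m × Fin m) :
    arcStep (slotArc a k z : Clustered L m r × Clustered L m r) = a := by
  simp [arcStep, slotArc]

lemma arcStep_extArc (hL : Odd L) (a : ZMod L) {z : (Fin m ⊕ Fin r) × (Fin m ⊕ Fin r)}
    (hz : ¬ (z.1.isRight ∧ z.2.isRight)) : arcStep (extArc a z) = a := by
  have h2 : (2 : ZMod L) * 2⁻¹ = 1 := by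
    exact_mod_cast ZMod.coe_mul_inv_eq_one 2 (Nat.coprime_two_left.2 hL)
  obtain ⟨x | j, y | j'⟩ := z
  · simp [arcStep, extArc, clusterEmb]
  · simp [arcStep, extArc, clusterEmb]
  · simp only [arcStep, extArc, clusterEmb, Sum.map_inl, Sum.map_inr, ← two_mul]
    linear_combination a * h2
  · simp at hz

/-- For each step `a`, the families `f a · k` and `h a` consist of disjoint perfect matchings of
the slots in the digraph with arcs `A`, and the resulting walks are transitive. -/
structure IsWalkFamily {I : Type*} (A : Clustered L m r × Clustered L m r → Prop)
    (f : (ZMod L)ˣ → I → ZMod L → Equiv.Perm (Fin m))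
    (h : (ZMod L)ˣ → I → Equiv.Perm (Fin m ⊕ Fin r)) : Prop where
  slot : ∀ a, ∀ k ≠ 1, IsMatchingFamily (fun z ↦ A (slotArc a.1 k z)) (f a · k)
  ext : ∀ a, IsMatchingFamily (fun z ↦ ¬ (z.1.isRight ∧ z.2.isRight) ∧ A (extArc a.1 z)) (h a)
  transitive : ∀ a i, ∃ k, IsTransitive (slotComp (slotMap (f a i) (h a i)) k L)

namespace IsWalkFamily

variable {I : Type*} {A : Clustered L m r × Clustered L m r → Prop}
  {f : (ZMod L)ˣ → I → ZMod L → Equiv.Perm (Fin m)}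
  {h : (ZMod L)ˣ → I → Equiv.Perm (Fin m ⊕ Fin r)} (H : IsWalkFamily A f h)
include H

lemma isTransitive_walk [NeZero L] (a : (ZMod L)ˣ) (i : I) :
    IsTransitive (walk (f a i) (h a i)) := by
  obtain ⟨k, hk⟩ := H.transitive a i
  exact HamiltonPacking.isTransitive_walk
    (fun j ↦ by simpa using ((H.ext a).1 i (.inr j)).1) hk

lemma adj_walk (a : (ZMod L)ˣ) (i : I) (u : Clustered L m r) :
    A (scale a u, scale a (walk (f a i) (h a i) u)) := by
  rcases eq_inl_or_eq_clusterEmb_one u with ⟨k, x, hk, rfl⟩ | ⟨z, rfl⟩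
  · exact scale_walk_inl (h := h a i) a hk x ▸ (H.slot a k hk).1 i x
  · exact scale_walk_clusterEmb_one (f := f a i) a z ▸ ((H.ext a).1 i z).2

lemma arcStep_walk (hL : Odd L) (a : (ZMod L)ˣ) (i : I) (u : Clustered L m r) :
    arcStep (scale a u, scale a (walk (f a i) (h a i) u)) = a := by
  rcases eq_inl_or_eq_clusterEmb_one u with ⟨k, x, hk, rfl⟩ | ⟨z, rfl⟩
  · rw [scale_walk_inl a hk, arcStep_slotArc]
  · rw [scale_walk_clusterEmb_one, arcStep_extArc hL _ ((H.ext a).1 i z).1]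

lemma eq_of_walk_eq {a : (ZMod L)ˣ} {i j : I} {u : Clustered L m r}
    (hij : walk (f a i) (h a i) u = walk (f a j) (h a j) u) : i = j := by
  rcases eq_inl_or_eq_clusterEmb_one u with ⟨k, x, hk, rfl⟩ | ⟨z, rfl⟩
  · simp only [walk_inl hk, Sum.inl.injEq, Prod.mk.injEq, true_and] at hij
    exact (H.slot a k hk).2 i j x hij
  · simp only [walk_clusterEmb_one] at hij
    exact (H.ext a).2 i j z (clusterEmb_injective 2 hij)

lemma eq_of_arc_eq (hL : Odd L) {a b : (ZMod L)ˣ} {i j : I} {u v : Clustered L m r}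
    (huv : (scale a u, scale a (walk (f a i) (h a i) u)) =
      (scale b v, scale b (walk (f b j) (h b j) v))) : (a, i) = (b, j) := by
  obtain rfl : a = b := Units.ext (by
    rw [← H.arcStep_walk hL a i u, huv, H.arcStep_walk hL b j v])
  simp only [Prod.mk.injEq, EmbeddingLike.apply_eq_iff_eq] at huv
  obtain ⟨rfl, huv⟩ := huv
  rw [H.eq_of_walk_eq huv]

theorem exists_isHamiltonPacking (hL : Odd L) [Fintype I] {V : Type*} [Finite V] [Nontrivial V]
    (e : Clustered L m r ≃ V) {D : Digraph V}
    (hD : ∀ u v, u ≠ v → A (u, v) → D.Adj (e u) (e v)) :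
    ∃ F, D.IsHamiltonPacking F ∧ F.card = Nat.card (ZMod L)ˣ * Fintype.card I := by
  classical
  have : NeZero L := ⟨hL.pos.ne'⟩
  have : Nontrivial (Clustered L m r) := e.nontrivial
  let ψ (a : (ZMod L)ˣ) : Clustered L m r ≃ V := (scale a).trans e
  let s (b : (ZMod L)ˣ × I) (v : V) : V := ψ b.1 (walk (f b.1 b.2) (h b.1 b.2) ((ψ b.1).symm v))
  have hs (b) : IsTransitive (s b) :=
    (H.isTransitive_walk b.1 b.2).conj (ψ b.1) fun u ↦ by simp [s]
  have hadj (b) (v : V) : D.Adj v (s b v) := by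
    obtain ⟨u, rfl⟩ := (ψ b.1).surjective v
    have hne : scale b.1 u ≠ scale b.1 (walk (f b.1 b.2) (h b.1 b.2) u) := fun hu ↦
      (H.isTransitive_walk b.1 b.2).apply_ne u ((scale b.1).injective hu.symm)
    simpa [s, ψ] using hD _ _ hne (H.adj_walk b.1 b.2 u)
  have hdisj (b b') (v : V) (hv : s b v = s b' v) : b = b' :=
    H.eq_of_arc_eq hL (Prod.ext (e.injective (((ψ b.1).apply_symm_apply v).trans
      ((ψ b'.1).apply_symm_apply v).symm)) (e.injective hv))
  obtain ⟨F, hF, hcard⟩ := exists_isHamiltonPacking_of_isTransitive hs hadj hdisj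
  exact ⟨F, hF, by rw [hcard, Fintype.card_prod, Nat.card_eq_fintype_card]⟩

end IsWalkFamily

end Packing

section Labels

variable {L m r N : ℕ}

/-- The label of an arc: `none` if it is absent, `some none` if it serves in the perfect matchings
between clusters, `some (some c)` if it may close walks in round `c`. -/
abbrev Label (N : ℕ) : Type := Option (Option (Fin N))

/-- Names of the walks with a fixed step: the slot at which the walk is closed to a single cycle,
and the round. -/
abbrev WalkIndex (L N : ℕ) : Type := {k : ZMod L // k ≠ 1} × Fin N

lemma card_walkIndex [NeZero L] : Fintype.card (WalkIndex L N) = (L - 1) * N := by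
  simp [Fintype.card_subtype_compl, ZMod.card]

open Classical in
/-- A choice of disjoint perfect matchings of `A`, with the junk value `1` if there is none. -/
noncomputable def matchings {Z : Type*} (I : Type*) (A : Z × Z → Prop) : I → Equiv.Perm Z :=
  if h : ∃ F : I → Equiv.Perm Z, IsMatchingFamily A F then h.choose else 1

lemma isMatchingFamily_matchings {Z I : Type*} {A : Z × Z → Prop}
    (h : ∃ F : I → Equiv.Perm Z, IsMatchingFamily A F) : IsMatchingFamily A (matchings I A) := by
  rw [matchings, dif_pos h]
  exact h.choose_spec

variable (lab : Clustered L m r × Clustered L m r → Label N) (a : (ZMod L)ˣ)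

/-- The bipartite graph of the matching arcs from the cluster `a * k` to the cluster `a * k + a`. -/
def slotGraph (k : ZMod L) (z : Fin m × Fin m) : Prop :=
  lab (slotArc a.1 k z) = some none

/-- The bipartite graph of the matching arcs from the cluster `a` to the cluster `a + a`, both
extended by the leftover vertices, without the arcs between leftover vertices. -/
def extGraph (z : (Fin m ⊕ Fin r) × (Fin m ⊕ Fin r)) : Prop :=
  ¬ (z.1.isRight ∧ z.2.isRight) ∧ lab (extArc a.1 z) = some none

/-- The bijections along the `i`-th walk with step `a`, before it is closed. -/
noncomputable def slotPerm (i : WalkIndex L N) : ZMod L → Equiv.Perm (Fin m) :=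
  slotMap (fun k ↦ matchings (WalkIndex L N) (slotGraph lab a k) i)
    (matchings (WalkIndex L N) (extGraph lab a) i)

/-- The paths of the `i`-th walk with step `a`, from the end of the slot at which the walk is closed
all around to the start of that slot, as a bijection from their starts to their ends. -/
noncomputable def pathPerm (i : WalkIndex L N) : Equiv.Perm (Fin m) :=
  slotComp (slotPerm lab a i) (i.1.1 + 1) (L - 1)

/-- The matching `τ` of arcs reserved for the `i`-th walk with step `a` closes the paths with
bijection `σ` to a single cycle. -/
def Closes (i : WalkIndex L N) (σ τ : Equiv.Perm (Fin m)) : Prop :=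
  (∀ x, lab (slotArc a.1 i.1.1 (x, τ x)) = some (some i.2)) ∧ IsTransitive (τ * σ)

/-- All the matchings exist and all the walks can be closed. -/
structure IsGoodLabelling : Prop where
  ext : ∀ a, ∃ F : WalkIndex L N → Equiv.Perm (Fin m ⊕ Fin r), IsMatchingFamily (extGraph lab a) F
  slot : ∀ a, ∀ k ≠ 1, ∃ F : WalkIndex L N → Equiv.Perm (Fin m),
    IsMatchingFamily (slotGraph lab a k) F
  closes : ∀ a i, ∃ τ, Closes lab a i (pathPerm lab a i) τ

variable {lab}

lemma isMatchingFamily_closed {k : ZMod L} {τ : WalkIndex L N → Equiv.Perm (Fin m)}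
    (hτ : ∀ i : WalkIndex L N, ∀ x, lab (slotArc a.1 i.1.1 (x, τ i x)) = some (some i.2))
    {F : WalkIndex L N → Equiv.Perm (Fin m)} (hF : IsMatchingFamily (slotGraph lab a k) F) :
    IsMatchingFamily (fun z ↦ lab (slotArc a.1 k z) ≠ none)
      fun i ↦ if i.1.1 = k then τ i else F i := by
  -- An arc of the closed walk `i` in slot `k` carries the label that names `i` if the walk is
  -- closed there, and a matching label otherwise.
  have hlab (i : WalkIndex L N) (x) : lab (slotArc a.1 k (x, (if i.1.1 = k then τ i else F i) x)) =
      if i.1.1 = k then some (some i.2) else some none := by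
    split_ifs with hi
    · exact hi ▸ hτ i x
    · exact hF.1 i x
  refine ⟨fun i x ↦ ?_, fun i j x hij ↦ ?_⟩
  · simp only [hlab]
    split_ifs <;> simp
  · have hlabel := hlab i x
    rw [hij, hlab j x] at hlabel
    by_cases hi : i.1.1 = k <;> by_cases hj : j.1.1 = k <;>
      simp only [hi, hj, if_true, if_false, Option.some.injEq, reduceCtorEq] at hlabel hij
    · exact Prod.ext (Subtype.ext (hi.trans hj.symm)) hlabel.symm
    · exact hF.2 i j x hij

lemma IsGoodLabelling.exists_isWalkFamily [NeZero L] (H : IsGoodLabelling lab) :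
    ∃ (f : (ZMod L)ˣ → WalkIndex L N → ZMod L → Equiv.Perm (Fin m))
      (h : (ZMod L)ˣ → WalkIndex L N → Equiv.Perm (Fin m ⊕ Fin r)),
      IsWalkFamily (fun b ↦ lab b ≠ none) f h := by
  choose τ hτlab hτ using H.closes
  let f (a : (ZMod L)ˣ) (i : WalkIndex L N) (k : ZMod L) : Equiv.Perm (Fin m) :=
    if i.1.1 = k then τ a i else matchings (WalkIndex L N) (slotGraph lab a k) i
  let h (a : (ZMod L)ˣ) := matchings (WalkIndex L N) (extGraph lab a)
  refine ⟨f, h, ⟨fun a k hk ↦ ?_, fun a ↦ ?_, fun a i ↦ ⟨i.1.1 + 1, ?_⟩⟩⟩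
  · exact isMatchingFamily_closed a (hτlab a) (isMatchingFamily_matchings (H.slot a k hk))
  · exact (isMatchingFamily_matchings (H.ext a)).mono fun z hz ↦ ⟨hz.1, by simp [hz.2]⟩
  · have hpath : slotComp (slotMap (f a i) (h a i)) (i.1.1 + 1) (L - 1) = pathPerm lab a i :=
      slotComp_congr fun j hj ↦ by
        simp only [slotPerm, slotMap, f, h, (add_one_add_natCast_ne i.1.1 hj).symm, if_false]
    have hclose : slotMap (f a i) (h a i) i.1.1 = τ a i := by
      simp [slotMap, f, i.1.2]
    rw [slotComp_add_one_self, hpath, hclose]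
    exact hτ a i

theorem IsGoodLabelling.exists_isHamiltonPacking [Fact L.Prime] (hL : 2 < L)
    (H : IsGoodLabelling lab) {V : Type*} [Finite V] [Nontrivial V] (e : Clustered L m r ≃ V)
    {D : Digraph V} (hD : ∀ u v, u ≠ v → lab (u, v) ≠ none → D.Adj (e u) (e v)) :
    ∃ F, D.IsHamiltonPacking F ∧ F.card = (L - 1) * ((L - 1) * N) := by
  have hLprime : L.Prime := Fact.out
  obtain ⟨f, h, hfh⟩ := H.exists_isWalkFamily
  obtain ⟨F, hF, hcard⟩ := hfh.exists_isHamiltonPacking (hLprime.odd_of_ne_two hL.ne') e hD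
  exact ⟨F, hF, by rw [hcard, card_walkIndex, Nat.card_eq_fintype_card, ZMod.card_units]⟩

/-- Hence the labels in the slot in which a walk is closed are independent of its paths. -/
lemma pathPerm_congr {lab' : Clustered L m r × Clustered L m r → Label N} (i : WalkIndex L N)
    (h : ∀ b ∉ Set.range (slotArc a.1 i.1.1), lab b = lab' b) :
    pathPerm lab a i = pathPerm lab' a i := by
  have hext : extGraph lab a = extGraph lab' a := by
    ext z
    have hz : extArc a.1 z ∉ Set.range (slotArc (m := m) (r := r) a.1 i.1.1) := by
      rintro ⟨w, hw⟩
      obtain ⟨x | j, y⟩ := z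
      · have hak : a.1 * i.1.1 = a.1 * 1 := by simp_all [slotArc, extArc, clusterEmb]
        exact i.1.2 (a.isUnit.mul_left_cancel hak)
      · simp [slotArc, extArc, clusterEmb] at hw
    rw [extGraph, extGraph, h _ hz]
  refine slotComp_congr fun j hj ↦ ?_
  set k := i.1.1 + 1 + (j : ZMod L)
  have hslot : slotGraph lab a k = slotGraph lab' a k := by
    ext z
    have hz : slotArc a.1 k z ∉ Set.range (slotArc (m := m) (r := r) a.1 i.1.1) := by
      rintro ⟨w, hw⟩
      have hak : a.1 * k = a.1 * i.1.1 := by simp_all [slotArc]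
      exact add_one_add_natCast_ne i.1.1 hj (a.isUnit.mul_left_cancel hak)
    rw [slotGraph, slotGraph, h _ hz]
  simp only [slotPerm, slotMap, hext, hslot]

end Labels

section RandomLabels

variable {Ω : Type*} [MeasurableSpace Ω] {μ : Measure Ω} {L m r N n : ℕ} {p q ε : ℝ}

lemma isBernoulliFamily_eq {β Λ : Type*} [MeasurableSpace Λ] [MeasurableSingletonClass Λ]
    {Y : β → Ω → Λ} (hYm : ∀ b, Measurable (Y b)) (hY : iIndepFun Y μ) {l : Λ}
    (hq : ∀ b, μ.real {ω | Y b ω = l} = q) : IsBernoulliFamily (fun b ω ↦ Y b ω = l) q μ := by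
  have hm : Measurable fun x : Λ ↦ x = l := measurableSet_setOfPred.1 (measurableSet_singleton l)
  exact ⟨fun b ↦ hm.comp (hYm b), hY.comp (fun _ x ↦ x = l) fun _ ↦ hm, hq⟩

lemma slotArc_injective (a k : ZMod L) :
    Function.Injective (slotArc a k : Fin m × Fin m → Clustered L m r × Clustered L m r) := by
  rintro ⟨x, y⟩ ⟨x', y'⟩ h
  simpa [slotArc] using h

lemma extArc_injective (a : ZMod L) :
    Function.Injective (extArc a : (Fin m ⊕ Fin r) × (Fin m ⊕ Fin r) →
      Clustered L m r × Clustered L m r) :=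
  (clusterEmb_injective a).prodMap (clusterEmb_injective (a + a))

/-- Labels carry the discrete σ-algebra. -/
instance instMeasurableSpaceLabel (N : ℕ) : MeasurableSpace (Label N) := ⊤

instance instDiscreteMeasurableSpaceLabel (N : ℕ) : DiscreteMeasurableSpace (Label N) :=
  ⟨fun _ ↦ trivial⟩

lemma measureReal_not_forall_le {ι : Type*} [Fintype ι] {P : ι → Ω → Prop} {c : ℝ}
    (h : ∀ i, μ.real {ω | ¬ P i ω} ≤ c) :
    μ.real {ω | ¬ ∀ i, P i ω} ≤ Fintype.card ι * c := by
  have hunion : {ω | ¬ ∀ i, P i ω} = ⋃ i, {ω | ¬ P i ω} := by ext; simp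
  rw [hunion]
  calc μ.real (⋃ i, {ω | ¬ P i ω}) ≤ ∑ i, μ.real {ω | ¬ P i ω} := measureReal_iUnion_fintype_le _
    _ ≤ ∑ _ : ι, c := Finset.sum_le_sum fun i _ ↦ h i
    _ = Fintype.card ι * c := by simp

variable [IsProbabilityMeasure μ] {Y : Clustered L m r × Clustered L m r → Ω → Label N}

lemma measureReal_not_exists_slotGraph_le [NeZero L]
    (hY : IsBernoulliFamily (fun b ω ↦ Y b ω = some none) p μ)
    (hε0 : 0 ≤ ε) (hε1 : ε ≤ 1) (hn : 0 < n) (hm : m ≤ n)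
    (hpm : 224 * Real.log n ≤ ε ^ 2 * (p * m))
    (hN : ((L - 1) * N : ℕ) ≤ (1 - ε) * (p * m)) (a : (ZMod L)ˣ) (k : ZMod L) :
    μ.real {ω | ¬ ∃ F : WalkIndex L N → Equiv.Perm (Fin m),
      IsMatchingFamily (slotGraph (Y · ω) a k) F} ≤ 2 * ((n : ℝ) ^ 3)⁻¹ := by
  have hmatch := measureReal_not_exists_isMatchingFamily_le (I := WalkIndex L N)
    (hY.precomp (slotArc_injective (m := m) a.1 k)) hε0 hε1 (Ex := ∅) (d := 0) (by simp) (by simp)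
    (by simpa using mul_nonneg hε0 m.cast_nonneg) hn (by simpa using hm) (by simpa using hpm)
    (by simpa only [card_walkIndex, Fintype.card_fin] using hN)
  refine (measureReal_mono (fun ω hω ⟨F, hF⟩ ↦ hω ⟨F, hF.mono fun z hz ↦ hz.2⟩)
    (measure_ne_top _ _)).trans hmatch

lemma measureReal_not_exists_extGraph_le [NeZero L]
    (hY : IsBernoulliFamily (fun b ω ↦ Y b ω = some none) p μ) (hp : 0 ≤ p)
    (hε0 : 0 ≤ ε) (hε1 : ε ≤ 1) (hn : 0 < n) (hm : m + r ≤ n)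
    (hpm : 224 * Real.log n ≤ ε ^ 2 * (p * m)) (hr : 4 * r ≤ ε * m)
    (hN : ((L - 1) * N : ℕ) ≤ (1 - ε) * (p * m)) (a : (ZMod L)ˣ) :
    μ.real {ω | ¬ ∃ F : WalkIndex L N → Equiv.Perm (Fin m ⊕ Fin r),
      IsMatchingFamily (extGraph (Y · ω) a) F} ≤ 2 * ((n : ℝ) ^ 3)⁻¹ := by
  classical
  let R : Finset (Fin m ⊕ Fin r) := Finset.univ.map .inr
  have hR_card : R.card = r := by simp [R]
  have hR (x : Fin m ⊕ Fin r) : x.isRight → x ∈ R := by cases x <;> simp [R]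
  have hrow (x) : ((R ×ˢ R).filter fun e ↦ e.1 = x).card ≤ r := by
    refine (Finset.card_le_card_of_injOn Prod.snd ?_ ?_).trans hR_card.le
    · rintro ⟨u, v⟩ h
      exact (Finset.mem_product.1 (Finset.mem_filter.1 h).1).2
    · rintro ⟨u, v⟩ h ⟨u', v'⟩ h' hv
      exact Prod.ext ((Finset.mem_filter.1 h).2.trans (Finset.mem_filter.1 h').2.symm) hv
  have hcol (y) : ((R ×ˢ R).filter fun e ↦ e.2 = y).card ≤ r := by
    refine (Finset.card_le_card_of_injOn Prod.fst ?_ ?_).trans hR_card.le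
    · rintro ⟨u, v⟩ h
      exact (Finset.mem_product.1 (Finset.mem_filter.1 h).1).1
    · rintro ⟨u, v⟩ h ⟨u', v'⟩ h' hu
      exact Prod.ext hu ((Finset.mem_filter.1 h).2.trans (Finset.mem_filter.1 h').2.symm)
  have hcard : (Fintype.card (Fin m ⊕ Fin r) : ℝ) = m + r := by simp
  have hm_le : (m : ℝ) ≤ m + r := le_add_of_nonneg_right r.cast_nonneg
  have hmatch := measureReal_not_exists_isMatchingFamily_le (I := WalkIndex L N)
    (hY.precomp (extArc_injective (m := m) (r := r) a.1)) hε0 hε1 hrow hcol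
    (hr.trans (by rw [hcard]; gcongr)) hn (by simpa using hm)
    (hpm.trans (by rw [hcard]; gcongr))
    (by rw [card_walkIndex, hcard]; exact hN.trans (by have := sub_nonneg.2 hε1; gcongr))
  refine (measureReal_mono (fun ω hω ⟨F, hF⟩ ↦ hω ⟨F, hF.mono fun z hz ↦ ⟨fun hz' ↦ ?_, hz.2⟩⟩)
    (measure_ne_top _ _)).trans hmatch
  exact hz.1 (Finset.mem_product.2 ⟨hR _ hz'.1, hR _ hz'.2⟩)

lemma measureReal_not_exists_closes_le [NeZero L] (hYm : ∀ b, Measurable (Y b))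
    (hY : iIndepFun Y μ) (hq : ∀ b c, μ.real {ω | Y b ω = some (some c)} = q)
    (hm : 17 ≤ m) (hmn : m ≤ n) (hqm : 64 * Real.log n ≤ q * m) (a : (ZMod L)ˣ)
    (i : WalkIndex L N) :
    μ.real {ω | ¬ ∃ τ, Closes (Y · ω) a i (pathPerm (Y · ω) a i) τ} ≤ 4 * ((n : ℝ) ^ 3)⁻¹ := by
  classical
  let T : Set (Clustered L m r × Clustered L m r) := Set.range (slotArc a.1 i.1.1)
  let E : Set (Clustered L m r × Clustered L m r → Label N) :=
    {lab | ¬ ∃ τ, Closes lab a i (pathPerm lab a i) τ}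
  refine measureReal_le_of_piecewise_le hY hYm T (E := E) (Set.toFinite _).measurableSet fun f ↦ ?_
  have hreserved : IsBernoulliFamily
      (fun z ω ↦ Y (slotArc a.1 i.1.1 z) ω = some (some i.2)) q μ :=
    (isBernoulliFamily_eq hYm hY fun b ↦ hq b i.2).precomp (slotArc_injective a.1 i.1.1)
  refine (measureReal_mono (fun ω hω ⟨τ, hτ, htrans⟩ ↦ hω ⟨τ, fun x ↦ ?_, ?_⟩)
    (measure_ne_top _ _)).trans (hreserved.measureReal_not_exists_isTransitive_le
      (by simpa using hm) (by simpa using hmn) (by simpa using hqm) (pathPerm f a i))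
  · rw [Set.piecewise_eq_of_mem _ _ _ (Set.mem_range_self _)]
    exact hτ x
  · rwa [pathPerm_congr a i fun b hb ↦ Set.piecewise_eq_of_notMem T _ f hb]

theorem measureReal_not_isGoodLabelling_le [NeZero L] (hYm : ∀ b, Measurable (Y b))
    (hY : iIndepFun Y μ) (hp : ∀ b, μ.real {ω | Y b ω = some none} = p)
    (hq : ∀ b c, μ.real {ω | Y b ω = some (some c)} = q)
    (hε0 : 0 ≤ ε) (hε1 : ε ≤ 1) (hm : 17 ≤ m) (hmn : m + r ≤ n) (hr : 4 * r ≤ ε * m)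
    (hpm : 224 * Real.log n ≤ ε ^ 2 * (p * m)) (hqm : 64 * Real.log n ≤ q * m)
    (hN : ((L - 1) * N : ℕ) ≤ (1 - ε) * (p * m)) :
    μ.real {ω | ¬ IsGoodLabelling (Y · ω)} ≤ 4 * L ^ 2 * (N + 1) * ((n : ℝ) ^ 3)⁻¹ := by
  have hn : 0 < n := by lia
  have hpY : IsBernoulliFamily (fun b ω ↦ Y b ω = some none) p μ := isBernoulliFamily_eq hYm hY hp
  have hp0 : 0 ≤ p := by
    have : NeZero m := ⟨by lia⟩
    have : Nonempty (Clustered L m r × Clustered L m r) := ⟨.inl 0, .inl 0⟩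
    exact hpY.nonneg
  let E₁ : Set Ω := {ω | ¬ ∀ a, ∃ F : WalkIndex L N → Equiv.Perm (Fin m ⊕ Fin r),
    IsMatchingFamily (extGraph (Y · ω) a) F}
  let E₂ : Set Ω := {ω | ¬ ∀ i : (ZMod L)ˣ × {k : ZMod L // k ≠ 1},
    ∃ F : WalkIndex L N → Equiv.Perm (Fin m), IsMatchingFamily (slotGraph (Y · ω) i.1 i.2.1) F}
  let E₃ : Set Ω := {ω | ¬ ∀ i : (ZMod L)ˣ × WalkIndex L N,
    ∃ τ, Closes (Y · ω) i.1 i.2 (pathPerm (Y · ω) i.1 i.2) τ}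
  have hE₁ : μ.real E₁ ≤ _ := measureReal_not_forall_le
    (measureReal_not_exists_extGraph_le hpY hp0 hε0 hε1 hn hmn hpm hr hN)
  have hE₂ : μ.real E₂ ≤ _ := measureReal_not_forall_le fun i ↦
    measureReal_not_exists_slotGraph_le hpY hε0 hε1 hn (by lia) hpm hN i.1 i.2.1
  have hE₃ : μ.real E₃ ≤ _ := measureReal_not_forall_le fun i ↦
    measureReal_not_exists_closes_le hYm hY hq hm (by lia) hqm i.1 i.2
  have hsub : {ω | ¬ IsGoodLabelling (Y · ω)} ⊆ E₁ ∪ (E₂ ∪ E₃) := fun ω hω ↦ by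
    by_contra h
    simp only [Set.mem_union, not_or] at h
    exact hω ⟨not_not.1 h.1, fun a k hk ↦ not_not.1 h.2.1 (a, ⟨k, hk⟩),
      fun a i ↦ not_not.1 h.2.2 (a, i)⟩
  have hunits : (Fintype.card (ZMod L)ˣ : ℝ) ≤ L := by
    exact_mod_cast (Fintype.card_le_of_injective _ Units.val_injective).trans_eq (ZMod.card L)
  have hslots : (Fintype.card {k : ZMod L // k ≠ 1} : ℝ) ≤ L := by
    exact_mod_cast (Fintype.card_subtype_le _).trans_eq (ZMod.card L)
  calc μ.real {ω | ¬ IsGoodLabelling (Y · ω)}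
      ≤ μ.real E₁ + (μ.real E₂ + μ.real E₃) :=
        (measureReal_mono hsub (measure_ne_top _ _)).trans <|
          (measureReal_union_le _ _).trans (by gcongr; exact measureReal_union_le _ _)
    _ ≤ L * (2 * ((n : ℝ) ^ 3)⁻¹) +
          (L * L * (2 * ((n : ℝ) ^ 3)⁻¹) + L * (L * N) * (4 * ((n : ℝ) ^ 3)⁻¹)) := by
        rw [Fintype.card_prod, Nat.cast_mul] at hE₂ hE₃
        rw [Fintype.card_prod, Nat.cast_mul, Fintype.card_fin] at hE₃
        refine add_le_add (hE₁.trans ?_) (add_le_add (hE₂.trans ?_) (hE₃.trans ?_)) <;> gcongr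
    _ = (2 * L + 2 * L ^ 2 + 4 * L ^ 2 * N) * ((n : ℝ) ^ 3)⁻¹ := by ring
    _ ≤ 4 * L ^ 2 * (N + 1) * ((n : ℝ) ^ 3)⁻¹ := by
        have hL : (L : ℝ) ≤ L ^ 2 := by exact_mod_cast Nat.le_self_pow two_ne_zero L
        gcongr
        linarith

end RandomLabels

section Law

open unitInterval

variable {Ω β : Type*} [MeasurableSpace Ω] {μ : Measure Ω} [IsProbabilityMeasure μ]
  {ξ : β → Ω → Prop} {p : unitInterval}

namespace IsBernoulliFamily

lemma not {q : ℝ} (h : IsBernoulliFamily ξ q μ) : IsBernoulliFamily (fun b ω ↦ ¬ ξ b ω) (1 - q) μ :=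
  ⟨fun b ↦ (h.measurable b).not, h.indep.comp (fun _ x ↦ ¬ x) fun _ ↦ .of_discrete,
    fun b ↦ by rw [← h.prob b, ← probReal_compl_eq_one_sub (h.measurableSet b)]; rfl⟩

lemma map_eq (h : IsBernoulliFamily ξ p μ) (b : β) :
    μ.map (ξ b) = toNNReal p • Measure.dirac True + toNNReal (σ p) • Measure.dirac False := by
  have : IsProbabilityMeasure (μ.map (ξ b)) :=
    Measure.isProbabilityMeasure_map (h.measurable b).aemeasurable
  have htrue : (μ.map (ξ b)).real {True} = p := by
    rw [map_measureReal_apply (h.measurable b) .of_discrete, ← h.prob b]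
    congr 1
    ext ω
    simp
  have hfalse : (μ.map (ξ b)).real {False} = 1 - p := by
    rw [← htrue, ← probReal_compl_eq_one_sub .of_discrete]
    congr 1
    ext x
    simp
  refine Measure.ext_of_singleton fun x ↦ ?_
  by_cases hx : x
  · rw [eq_true hx, ← measureReal_eq_measureReal_iff, htrue, measureReal_add_apply,
      measureReal_nnreal_smul_apply, measureReal_nnreal_smul_apply, measureReal_def,
      measureReal_def, Measure.dirac_apply, Measure.dirac_apply]
    simp
  · rw [eq_false hx, ← measureReal_eq_measureReal_iff, hfalse, measureReal_add_apply,
      measureReal_nnreal_smul_apply, measureReal_nnreal_smul_apply, measureReal_def,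
      measureReal_def, Measure.dirac_apply, Measure.dirac_apply]
    simp

lemma isSetBernoulli [Countable β] (h : IsBernoulliFamily ξ p μ) (u : Set β) :
    IsSetBernoulli (fun ω ↦ {b | b ∈ u ∧ ξ b ω}) u p μ := by
  have hm (b) : Measurable fun ω ↦ b ∈ u ∧ ξ b ω :=
    measurable_const.and (h.measurable b)
  have hlaw (b) : μ.map (fun ω ↦ b ∈ u ∧ ξ b ω) =
      toNNReal p • Measure.dirac (b ∈ u) + toNNReal (σ p) • Measure.dirac False := by
    have hand : Measurable fun x : Prop ↦ b ∈ u ∧ x := .of_discrete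
    calc μ.map (fun ω ↦ b ∈ u ∧ ξ b ω) = (μ.map (ξ b)).map fun x ↦ b ∈ u ∧ x :=
          (Measure.map_map hand (h.measurable b)).symm
      _ = _ := by
        rw [h.map_eq, Measure.map_add _ _ hand]
        simp [Measure.map_smul, Measure.map_dirac' hand]
  have hindep : iIndepFun (fun b ω ↦ b ∈ u ∧ ξ b ω) μ :=
    h.indep.comp (fun b x ↦ b ∈ u ∧ x) fun _ ↦ .of_discrete
  have hset : Measurable fun x : β → Prop ↦ {b | x b} := MeasurableEquiv.setOfPred.measurable
  refine ⟨(hset.comp (measurable_pi_lambda _ hm)).aemeasurable, ?_⟩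
  rw [setBernoulli_eq_map]
  simp only [← hlaw]
  rw [← hindep.map_fun_eq_infinitePi_map hm, Measure.map_map hset (measurable_pi_lambda _ hm)]
  rfl

end IsBernoulliFamily

lemma random_eq_map {n : ℕ} {ξ : Fin n × Fin n → Ω → Prop} (h : IsBernoulliFamily ξ p μ) :
    Digraph.random n p = μ.map fun ω ↦ Digraph.ofArcSet {a | a.1 ≠ a.2 ∧ ξ a ω} := by
  have hlaw := h.isSetBernoulli {a | a.1 ≠ a.2}
  rw [Digraph.random, ← hlaw.map_eq, AEMeasurable.map_map_of_aemeasurable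
    (Digraph.measurable_ofArcSet n).aemeasurable hlaw.aemeasurable]
  rfl

lemma exists_iIndepFun_eval {Λ : Type*} [Fintype Λ] [MeasurableSpace Λ]
    [DiscreteMeasurableSpace Λ] {w : Λ → ℝ} (hw : ∀ l, 0 ≤ w l) (hsum : ∑ l, w l = 1)
    (β : Type*) [Finite β] :
    ∃ μ : Measure (β → Λ), IsProbabilityMeasure μ ∧ iIndepFun (fun b ω ↦ ω b) μ ∧
      ∀ b l, μ.real {ω | ω b = l} = w l := by
  have := Fintype.ofFinite β
  let P : PMF Λ := PMF.ofFintype (fun l ↦ ENNReal.ofReal (w l)) <| by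
    rw [← ENNReal.ofReal_sum_of_nonneg fun l _ ↦ hw l, hsum, ENNReal.ofReal_one]
  have hP (l) : P.toMeasure.real {l} = w l := by
    rw [measureReal_def, PMF.toMeasure_apply_singleton _ _ (.of_discrete)]
    exact ENNReal.toReal_ofReal (hw l)
  refine ⟨Measure.pi fun _ ↦ P.toMeasure, inferInstance,
    iIndepFun_pi (X := fun _ l ↦ l) fun _ ↦ aemeasurable_id, fun b l ↦ ?_⟩
  calc _ = ((Measure.pi fun _ ↦ P.toMeasure).map (Function.eval b)).real {l} :=
        (map_measureReal_apply (measurable_pi_apply b) .of_discrete).symm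
    _ = w l := by rw [(measurePreserving_eval (fun _ : β ↦ P.toMeasure) b).map_eq, hP]

theorem le_measureReal_exists_isHamiltonPacking {n L m r N : ℕ} [Fact L.Prime] (hL : 2 < L)
    (hn : L * m + r = n) (p : unitInterval) {q ε : ℝ} (hq : 0 ≤ q) (hNq : N * q ≤ p)
    (hε0 : 0 ≤ ε) (hε1 : ε ≤ 1) (hm : 17 ≤ m) (hr : 4 * r ≤ ε * m)
    (hpm : 224 * Real.log n ≤ ε ^ 2 * ((p - N * q) * m)) (hqm : 64 * Real.log n ≤ q * m)
    (hN : ((L - 1) * N : ℕ) ≤ (1 - ε) * ((p - N * q) * m)) :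
    1 - 4 * L ^ 2 * (N + 1) * ((n : ℝ) ^ 3)⁻¹ ≤ (Digraph.random n p).real
      {D | ∃ F, D.IsHamiltonPacking F ∧ F.card = (L - 1) * ((L - 1) * N)} := by
  have : Nontrivial (Fin n) := Fin.nontrivial_iff_two_le.2 (by nlinarith)
  obtain ⟨μ, hμ, hindep, hprob⟩ := exists_iIndepFun_eval (Λ := Label N)
    (w := fun l ↦ l.elim (1 - p) fun o ↦ o.elim (p - N * q) fun _ ↦ q)
    (by rintro (_ | _ | _) <;> simp [hq, hNq, p.2.2]) (by simp [Fintype.sum_option])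
    (Fin n × Fin n)
  have harc : IsBernoulliFamily (fun (a : Fin n × Fin n) (ω : _ → Label N) ↦ ω a ≠ none) p μ := by
    simpa using (isBernoulliFamily_eq measurable_pi_apply hindep fun b ↦ hprob b none).not
  let e : Clustered L m r ≃ Fin n := Fintype.equivFinOfCardEq (by simp [ZMod.card, hn])
  let Y (b : Clustered L m r × Clustered L m r) (ω : Fin n × Fin n → Label N) : Label N :=
    ω (e b.1, e b.2)
  have hbad : μ.real {ω | ¬ IsGoodLabelling (Y · ω)} ≤ 4 * L ^ 2 * (N + 1) * ((n : ℝ) ^ 3)⁻¹ :=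
    measureReal_not_isGoodLabelling_le (fun b ↦ measurable_pi_apply _)
      (hindep.precomp (e.prodCongr e).injective) (fun b ↦ hprob _ _) (fun b c ↦ hprob _ _)
      hε0 hε1 hm (by nlinarith) hr hpm hqm hN
  rw [random_eq_map harc, map_measureReal_apply (measurable_of_countable _)
    MeasurableSpace.measurableSet_top]
  calc 1 - 4 * L ^ 2 * (N + 1) * ((n : ℝ) ^ 3)⁻¹
      ≤ 1 - μ.real {ω | ¬ IsGoodLabelling (Y · ω)} := by gcongr
    _ = μ.real {ω | IsGoodLabelling (Y · ω)} := by
      rw [← probReal_compl_eq_one_sub (Set.toFinite _).measurableSet]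
      simp [Set.compl_ofPred]
    _ ≤ _ := by
      refine measureReal_mono (fun ω hω ↦ ?_) (measure_ne_top _ _)
      exact hω.exists_isHamiltonPacking hL e fun u v huv hlab ↦ ⟨e.injective.ne huv, hlab⟩

end Law

section Asymptotics

lemma exists_prime_le_sub_one {x : ℝ} (hx : 1 ≤ x) :
    ∃ L : ℕ, L.Prime ∧ x ≤ L - 1 ∧ (L : ℝ) ≤ 4 * x := by
  have hceil : ⌈x⌉₊ ≠ 0 := (Nat.ceil_pos.2 (by linarith)).ne'
  obtain ⟨L, hLprime, hlt, hle⟩ := Nat.exists_prime_lt_and_le_two_mul ⌈x⌉₊ hceil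
  have hx_le : x ≤ ⌈x⌉₊ := Nat.le_ceil x
  have hceil_lt : (⌈x⌉₊ : ℝ) < x + 1 := Nat.ceil_lt_add_one (by linarith)
  have hlt' : (⌈x⌉₊ : ℝ) + 1 ≤ L := by exact_mod_cast hlt
  have hle' : (L : ℝ) ≤ 2 * ⌈x⌉₊ := by exact_mod_cast hle
  exact ⟨L, hLprime, by linarith, by linarith⟩

/-- The probability that an arc is reserved for closing the walks in a given round. -/
noncomputable def reserve (n m : ℕ) : ℝ := 64 * Real.log n / m

lemma reserve_nonneg (n m : ℕ) : 0 ≤ reserve n m :=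
  div_nonneg (mul_nonneg (by norm_num) (Real.log_natCast_nonneg n)) m.cast_nonneg

/-- The choice of the number `L` of clusters of size `m`, with `r` leftover vertices, for the random
digraph on `n` vertices with arc probability `p`, when the tolerance is `ε`. -/
structure IsClustering (n L m r : ℕ) (p ε : ℝ) : Prop where
  eps_pos : 0 < ε
  eps_le : ε ≤ 1 / 4
  p_nonneg : 0 ≤ p
  p_le_one : p ≤ 1
  log_ge : 64 ≤ ε * Real.log n
  mul_ge : 1024 * Real.log n ^ 4 ≤ ε * (n * p)
  sq_log_le : Real.log n ^ 2 ≤ L - 1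
  le_sq_log : L ≤ 4 * Real.log n ^ 2
  card_eq : L * m + r = n
  rest_lt : r < L

namespace IsClustering

variable {n L m r N : ℕ} {p ε : ℝ}

lemma le_log (h : IsClustering n L m r p ε) : 256 ≤ Real.log n := by
  have hlog : 0 ≤ Real.log n := Real.log_natCast_nonneg n
  nlinarith [h.log_ge, mul_le_mul_of_nonneg_right h.eps_le hlog]

lemma log_le_sq_log (h : IsClustering n L m r p ε) : 256 * Real.log n ≤ Real.log n ^ 2 := by
  nlinarith [h.le_log]

lemma log_le_mul_sq_log (h : IsClustering n L m r p ε) :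
    64 * Real.log n ≤ ε * Real.log n ^ 2 := by
  nlinarith [h.le_log, h.log_ge]

lemma log_pow_four_le (h : IsClustering n L m r p ε) : 1024 * Real.log n ^ 4 ≤ ε * n :=
  h.mul_ge.trans <| mul_le_mul_of_nonneg_left
    (mul_le_of_le_one_right n.cast_nonneg h.p_le_one) h.eps_pos.le

lemma sq_log_le_log_pow_four (h : IsClustering n L m r p ε) :
    65536 * Real.log n ^ 2 ≤ Real.log n ^ 4 := by
  have hsq : 256 ^ 2 ≤ Real.log n ^ 2 := by gcongr; exact h.le_log
  calc 65536 * Real.log n ^ 2 ≤ Real.log n ^ 2 * Real.log n ^ 2 := by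
        gcongr
        linarith
    _ = Real.log n ^ 4 := by ring

lemma le_mul_card (h : IsClustering n L m r p ε) : (n : ℝ) ≤ 8 * Real.log n ^ 2 * m := by
  have hcard : (L * m + r : ℝ) = n := by exact_mod_cast h.card_eq
  have hr : (r : ℝ) ≤ L := by exact_mod_cast h.rest_lt.le
  have hLm : (L * m : ℝ) ≤ 4 * Real.log n ^ 2 * m := by
    gcongr
    exact h.le_sq_log
  have hεn : ε * n ≤ n := mul_le_of_le_one_left n.cast_nonneg (h.eps_le.trans (by norm_num))
  linarith [h.le_sq_log, h.log_pow_four_le, h.sq_log_le_log_pow_four]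

lemma sq_log_le_mul (h : IsClustering n L m r p ε) : 128 * Real.log n ^ 2 ≤ ε * (p * m) := by
  have hε := h.eps_pos
  have hp := h.p_nonneg
  have hlog := h.le_log
  have hmul : 8 * Real.log n ^ 2 * (128 * Real.log n ^ 2) ≤
      8 * Real.log n ^ 2 * (ε * (p * m)) :=
    calc 8 * Real.log n ^ 2 * (128 * Real.log n ^ 2) = 1024 * Real.log n ^ 4 := by ring
      _ ≤ ε * (n * p) := h.mul_ge
      _ ≤ ε * (8 * Real.log n ^ 2 * m * p) := by
        gcongr
        exact h.le_mul_card
      _ = 8 * Real.log n ^ 2 * (ε * (p * m)) := by ring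
  exact le_of_mul_le_mul_left hmul (by positivity)

lemma sq_log_le_mul_card (h : IsClustering n L m r p ε) : 128 * Real.log n ^ 2 ≤ ε * m :=
  h.sq_log_le_mul.trans <| mul_le_mul_of_nonneg_left
    (mul_le_of_le_one_left m.cast_nonneg h.p_le_one) h.eps_pos.le

lemma log_le_card (h : IsClustering n L m r p ε) : 64 * Real.log n ≤ m := by
  have hm : ε * m ≤ m := mul_le_of_le_one_left m.cast_nonneg (h.eps_le.trans (by norm_num))
  linarith [h.sq_log_le_mul_card, h.log_le_sq_log, h.le_log]

lemma le_card (h : IsClustering n L m r p ε) : 17 ≤ m := by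
  have : (17 : ℝ) ≤ m := by linarith [h.log_le_card, h.le_log]
  exact_mod_cast this

lemma rest_le (h : IsClustering n L m r p ε) : 4 * r ≤ ε * m := by
  have hr : (r : ℝ) ≤ L := by exact_mod_cast h.rest_lt.le
  linarith [h.le_sq_log, h.sq_log_le_mul_card, sq_nonneg (Real.log n)]

lemma reserve_mul (h : IsClustering n L m r p ε) : reserve n m * m = 64 * Real.log n := by
  have := h.le_card
  exact div_mul_cancel₀ _ (by positivity)

lemma mul_reserve_le (h : IsClustering n L m r p ε) (hN : (L - 1) * N ≤ p * m) :
    N * reserve n m ≤ ε * p := by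
  have hlog := h.le_log
  have hm : (0 : ℝ) < m := by exact_mod_cast (Nat.zero_lt_of_lt h.le_card)
  have hsN : Real.log n ^ 2 * N ≤ p * m :=
    (mul_le_mul_of_nonneg_right h.sq_log_le N.cast_nonneg).trans hN
  have hmul : Real.log n ^ 2 * m * (N * reserve n m) ≤ Real.log n ^ 2 * m * (ε * p) :=
    calc Real.log n ^ 2 * m * (N * reserve n m)
        = Real.log n ^ 2 * N * (64 * Real.log n) := by rw [← h.reserve_mul]; ring
      _ ≤ p * m * (ε * Real.log n ^ 2) := by
        have := mul_nonneg h.p_nonneg hm.le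
        gcongr ?_ * ?_
        exact h.log_le_mul_sq_log
      _ = Real.log n ^ 2 * m * (ε * p) := by ring
  exact le_of_mul_le_mul_left hmul (by positivity)

lemma le_sub_mul_reserve (h : IsClustering n L m r p ε) (hN : (L - 1) * N ≤ p * m) :
    (1 - ε) * (p * m) ≤ (p - N * reserve n m) * m := by
  nlinarith [h.mul_reserve_le hN, m.cast_nonneg (α := ℝ)]

lemma log_le_sub_mul_reserve (h : IsClustering n L m r p ε) (hN : (L - 1) * N ≤ p * m) :
    224 * Real.log n ≤ ε ^ 2 * ((p - N * reserve n m) * m) := by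
  have hε := h.eps_pos
  have hε' := h.eps_le
  have hpm : 0 ≤ p * m := mul_nonneg h.p_nonneg m.cast_nonneg
  calc 224 * Real.log n ≤ ε * (96 * Real.log n ^ 2) := by
        linarith [h.log_le_mul_sq_log, h.le_log]
    _ ≤ ε * (3 / 4 * (ε * (p * m))) :=
        mul_le_mul_of_nonneg_left (by linarith [h.sq_log_le_mul]) hε.le
    _ = ε ^ 2 * (3 / 4 * (p * m)) := by ring
    _ ≤ ε ^ 2 * ((1 - ε) * (p * m)) := by
        gcongr
        linarith
    _ ≤ ε ^ 2 * ((p - N * reserve n m) * m) :=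
        mul_le_mul_of_nonneg_left (h.le_sub_mul_reserve hN) (by positivity)

lemma sq_le (h : IsClustering n L m r p ε) : (L : ℝ) ^ 2 ≤ 16 * Real.log n ^ 4 :=
  calc (L : ℝ) ^ 2 ≤ (4 * Real.log n ^ 2) ^ 2 := by
        gcongr
        exact h.le_sq_log
    _ = 16 * Real.log n ^ 4 := by ring

lemma failure_le (h : IsClustering n L m r p ε) (hN : (L - 1) * N ≤ p * m) :
    4 * L ^ 2 * (N + 1) * ((n : ℝ) ^ 3)⁻¹ ≤ ε := by
  have hε := h.eps_pos
  have hmn : (m : ℝ) ≤ n := by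
    have := h.card_eq
    have := h.rest_lt
    exact_mod_cast (by nlinarith : m ≤ n)
  have hn : (2 : ℝ) ≤ n := by linarith [h.log_le_card, h.le_log]
  have hNn : (N + 1 : ℝ) ≤ n := by
    have hK : 2 ≤ (L - 1 : ℝ) := by linarith [h.sq_log_le, h.log_le_sq_log, h.le_log]
    have hKN : 2 * (N : ℝ) ≤ (L - 1) * N := mul_le_mul_of_nonneg_right hK N.cast_nonneg
    have hpm : p * m ≤ m := mul_le_of_le_one_left m.cast_nonneg h.p_le_one
    linarith [h.log_le_card, h.le_log]
  have hLn : 4 * (L : ℝ) ^ 2 ≤ ε * n := by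
    linarith [h.sq_le, h.log_pow_four_le, pow_nonneg (Real.log_natCast_nonneg n) 4]
  rw [← div_eq_mul_inv, div_le_iff₀ (by positivity)]
  calc 4 * L ^ 2 * (N + 1 : ℝ) ≤ ε * n * n := by gcongr
    _ ≤ ε * n * n * n := le_mul_of_one_le_right (by positivity) (by linarith)
    _ = ε * n ^ 3 := by ring

lemma le_card_packing (h : IsClustering n L m r p ε)
    (hN : (1 - 2 * ε) * (p * m) - (L - 1) ≤ (L - 1) * N) :
    (1 - 4 * ε) * (n * p) ≤ (L - 1) * ((L - 1) * N) := by
  have hK : 0 ≤ (L - 1 : ℝ) := (sq_nonneg _).trans h.sq_log_le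
  have hKK : (L - 1 : ℝ) * (L - 1) ≤ ε * (n * p) := by
    linarith [h.sq_le, h.mul_ge, pow_nonneg (Real.log_natCast_nonneg n) 4]
  have hKm : (1 - ε) * n ≤ (L - 1) * m := by
    have hcard : (L * m + r : ℝ) = n := by exact_mod_cast h.card_eq
    have hεL : 2 * (m : ℝ) ≤ ε * L * m := by
      gcongr
      calc 2 ≤ 64 * Real.log n := by linarith [h.le_log]
        _ ≤ ε * Real.log n ^ 2 := h.log_le_mul_sq_log
        _ ≤ ε * L := mul_le_mul_of_nonneg_left (by linarith [h.sq_log_le]) h.eps_pos.le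
    have hεr : 0 ≤ ε * r := mul_nonneg h.eps_pos.le r.cast_nonneg
    have hεm : ε * m ≤ 1 / 4 * m := mul_le_mul_of_nonneg_right h.eps_le m.cast_nonneg
    rw [← hcard]
    linarith [h.rest_le]
  calc (1 - 4 * ε) * (n * p) ≤ (1 - 2 * ε) * ((1 - ε) * n * p) - ε * (n * p) := by
        linarith [mul_nonneg (sq_nonneg ε) (mul_nonneg n.cast_nonneg h.p_nonneg)]
    _ ≤ (1 - 2 * ε) * ((L - 1) * m * p) - (L - 1) * (L - 1) := by
        gcongr
        exacts [by linarith [h.eps_le], h.p_nonneg]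
    _ = (L - 1) * ((1 - 2 * ε) * (p * m) - (L - 1)) := by ring
    _ ≤ (L - 1) * ((L - 1) * N) := mul_le_mul_of_nonneg_left hN hK

end IsClustering

lemma exists_nat_mul_le {K x : ℝ} (hK : 0 < K) (hx : 0 ≤ x) :
    ∃ N : ℕ, K * N ≤ x ∧ x - K ≤ K * N := by
  have hle := Nat.floor_le (div_nonneg hx hK.le)
  have hlt := Nat.lt_floor_add_one (x / K)
  rw [le_div_iff₀' hK] at hle
  rw [div_lt_iff₀' hK] at hlt
  exact ⟨_, hle, by linarith⟩

lemma exists_isClustering {n : ℕ} {p ε : ℝ} (hε : 0 < ε) (hε' : ε ≤ 1 / 4) (hp : 0 ≤ p)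
    (hp' : p ≤ 1) (hlog : 64 ≤ ε * Real.log n) (hnp : 1024 * Real.log n ^ 4 ≤ ε * (n * p)) :
    ∃ L m r : ℕ, L.Prime ∧ IsClustering n L m r p ε := by
  have hlog_ge : 256 ≤ Real.log n := by
    nlinarith [Real.log_natCast_nonneg n]
  obtain ⟨L, hLprime, hle, hge⟩ := exists_prime_le_sub_one (x := Real.log n ^ 2) (by nlinarith)
  exact ⟨L, n / L, n % L, hLprime, hε, hε', hp, hp', hlog, hnp, hle, hge, Nat.div_add_mod n L,
    Nat.mod_lt n hLprime.pos⟩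

theorem one_sub_le_measureReal_exists_isHamiltonPacking {n : ℕ} (p : unitInterval) {ε : ℝ}
    (hε : 0 < ε) (hε' : ε ≤ 1 / 4) (hlog : 64 ≤ ε * Real.log n)
    (hnp : 1024 * Real.log n ^ 4 ≤ ε * (n * p)) :
    1 - ε ≤ (Digraph.random n p).real
      {D | ∃ F : Finset (Set (Fin n × Fin n)),
        D.IsHamiltonPacking F ∧ (1 - 4 * ε) * (n * p) ≤ (F.card : ℝ)} := by
  obtain ⟨L, m, r, hLprime, h⟩ := exists_isClustering hε hε' p.2.1 p.2.2 hlog hnp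
  have : Fact L.Prime := ⟨hLprime⟩
  have hpm : 0 ≤ (p : ℝ) * m := mul_nonneg p.2.1 m.cast_nonneg
  have hL : 2 < (L : ℝ) := by nlinarith [h.le_log, h.sq_log_le]
  obtain ⟨N, hNle, hNge⟩ := exists_nat_mul_le (K := L - 1) (x := (1 - 2 * ε) * (p * m))
    (by linarith) (mul_nonneg (by linarith) hpm)
  have hNpm : (L - 1) * N ≤ (p * m : ℝ) := hNle.trans (mul_le_of_le_one_left hpm (by linarith))
  have hLcast : ((L - 1 : ℕ) : ℝ) = L - 1 := by
    rw [Nat.cast_sub hLprime.one_lt.le, Nat.cast_one]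
  have hNq : N * reserve n m ≤ (p : ℝ) :=
    (h.mul_reserve_le hNpm).trans (mul_le_of_le_one_left p.2.1 (by linarith))
  have hNP : ((L - 1) * N : ℕ) ≤ (1 - ε) * ((p - N * reserve n m) * m) :=
    calc (((L - 1) * N : ℕ) : ℝ) = (L - 1) * N := by rw [Nat.cast_mul, hLcast]
      _ ≤ (1 - ε) * ((1 - ε) * (p * m)) := by linarith [mul_nonneg (sq_nonneg ε) hpm]
      _ ≤ _ := mul_le_mul_of_nonneg_left (h.le_sub_mul_reserve hNpm) (by linarith)
  have hpack := le_measureReal_exists_isHamiltonPacking (L := L) (by exact_mod_cast hL) h.card_eq p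
    (reserve_nonneg n m) hNq hε.le (by linarith) h.le_card h.rest_le
    (h.log_le_sub_mul_reserve hNpm) h.reserve_mul.ge hNP
  calc 1 - ε ≤ 1 - 4 * L ^ 2 * (N + 1) * ((n : ℝ) ^ 3)⁻¹ := by
        gcongr
        exact h.failure_le hNpm
    _ ≤ _ := hpack
    _ ≤ _ := by
        refine measureReal_mono ?_ (measure_ne_top _ _)
        rintro D ⟨F, hF, hcard⟩
        refine ⟨F, hF, ?_⟩
        rw [hcard, Nat.cast_mul, Nat.cast_mul, hLcast]
        exact h.le_card_packing hNge

lemma exists_tendsto_zero_of_isLittleO {p : ℕ → ℝ} (hp0 : ∀ n, 0 ≤ p n)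
    (hp : (fun n : ℕ ↦ Real.log n ^ 4 / n) =o[Filter.atTop] p) :
    ∃ δ : ℕ → ℝ, Filter.Tendsto δ Filter.atTop (nhds 0) ∧ ∀ᶠ n in Filter.atTop,
      0 < δ n ∧ 64 ≤ δ n * Real.log n ∧ 1024 * Real.log n ^ 4 ≤ δ n * (n * p n) := by
  have hlog : Filter.Tendsto (fun n : ℕ ↦ Real.log n) Filter.atTop Filter.atTop :=
    Real.tendsto_log_atTop.comp tendsto_natCast_atTop_atTop
  refine ⟨fun n ↦ 64 / Real.log n + 1024 * (Real.log n ^ 4 / n / p n), ?_, ?_⟩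
  · simpa using (hlog.const_div_atTop 64).add (hp.tendsto_div_nhds_zero.const_mul 1024)
  filter_upwards [hlog.eventually_gt_atTop 0, hp.bound one_pos, Filter.eventually_gt_atTop 0]
    with n hlog_pos hbound hn
  have hp_pos : 0 < p n := by
    rw [one_mul, Real.norm_of_nonneg (by positivity), Real.norm_of_nonneg (hp0 n)] at hbound
    exact lt_of_lt_of_le (by positivity) hbound
  have hcancel_log : 64 / Real.log n * Real.log n = 64 := by field_simp
  have hcancel : 1024 * (Real.log n ^ 4 / n / p n) * (n * p n) = 1024 * Real.log n ^ 4 := by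
    field_simp
  refine ⟨by positivity, ?_, ?_⟩
  · rw [add_mul, hcancel_log]
    exact le_add_of_nonneg_right (by positivity)
  · rw [add_mul, hcancel]
    exact le_add_of_nonneg_left (by positivity)

end Asymptotics

end HamiltonPacking

theorem theorem1p1 (p : ℕ → unitInterval)
    (hp : (fun n : ℕ => Real.log (n : ℝ) ^ 4 / (n : ℝ)) =o[Filter.atTop]
      (fun n : ℕ => (p n : ℝ))) :
    ∃ ε : ℕ → ℝ, Filter.Tendsto ε Filter.atTop (nhds 0) ∧
      Filter.Tendsto
        (fun n : ℕ => (Digraph.random n (p n)).real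
          {D | ∃ F : Finset (Set (Fin n × Fin n)),
            D.IsHamiltonPacking F ∧ (1 - ε n) * ((n : ℝ) * (p n : ℝ)) ≤ (F.card : ℝ)})
        Filter.atTop (nhds 1) := by
  obtain ⟨δ, hδ, hlarge⟩ :=
    HamiltonPacking.exists_tendsto_zero_of_isLittleO (fun n ↦ (p n).2.1) hp
  refine ⟨fun n ↦ 4 * δ n, by simpa using hδ.const_mul 4, ?_⟩
  have hlower : Filter.Tendsto (fun n ↦ 1 - δ n) Filter.atTop (nhds 1) := by
    simpa using hδ.const_sub 1
  refine tendsto_of_tendsto_of_tendsto_of_le_of_le' hlower tendsto_const_nhds ?_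
    (.of_forall fun n ↦ MeasureTheory.measureReal_le_one)
  filter_upwards [hlarge, hδ.eventually_le_const (show (0 : ℝ) < 1 / 4 by norm_num)]
    with n ⟨hδ_pos, hlog, hnp⟩ hδ_le
  exact HamiltonPacking.one_sub_le_measureReal_exists_isHamiltonPacking (p n) hδ_pos hδ_le hlog hnp
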